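/- Let $n\ge 0$, let $D(x)=(D_{ij}(x))$ be a symmetric nonnegative $n\times n$ matrix with smooth entries on $\mathbb R^n$, and let $a:\mathbb R^n\to\mathbb R^n$ be smooth. Let $(P_t)_{t\ge0}$ be a Markov semigroup on $\mathbb R^n$, given by transition probability kernels, whose infinitesimal generator is the diffusion operator $Lf=\mathrm{div}(D\nabla f)-\langle Da,\nabla f\rangle$: for every $f\in C_c^\infty(\mathbb R^n)$, $(P_tf-f)/t\to Lf$ boundedly and pointwise as $t\to0^+$. Let $\Gamma(f)=\frac12\big(L(f^2)-2fLf\big)=\langle\nabla f,D\nabla f\rangle$. Let $\mu=u_\infty\,dx$ be an invariant probability measure of $(P_t)$ with a positive density $u_\infty$ of class $C^2$. Let $\Phi$ be a convex $C^2$ function on an interval $I\subset\mathbb R$ and, for $I$-valued $f$ with $f$ and $\Phi(f)$ $\mu$-integrable, let $\mathrm{Ent}_\mu^\Phi(f)=\int\Phi(f)\,d\mu-\Phi\big(\int f\,d\mu\big)$. Assume that, for some $C>0$, $\mu$ satisfies the $\Phi$-entropy inequality $$\mathrm{Ent}_\mu^\Phi(f)\le C\int\Phi''(f)\,\Gamma(f)\,d\mu$$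 for all $I$-valued $C^2$ functions $f$ with $f$ and $\Phi(f)$ $\mu$-integrable (the right-hand side may be $+\infty$). Let $u=(u_t)_{t\ge0}$ be a solution of the Fokker–Planck equation $\partial_tu_t=\mathrm{div}[D(\nabla u_t+u_ta)]$, in the following sense: $u,\nabla u,\nabla^2u$ are continuous on $(0,\infty)\times\mathbb R^n$ and the equation holds there pointwise; each $u_t$, $t\ge0$, is Lebesgue-integrable, with $\|u_t\|_{L^1(dx)}$ bounded on bounded time intervals; and $\partial_tu=L^*u$ holds in duality with the generator, that is, $\int fu_t\,dx-\int fu_0\,dx=\int_0^t\int g\,u_s\,dx\,ds$ for all $t\ge0$ whenever $f$ is bounded Borel and $(P_tf-f)/t\to g$ boundedly and pointwise as $t\to0^+$. Assume that $u_t/u_\infty$ is $I$-valued for all $t\ge0$ and that $\Phi(u_0/u_\infty)$ is $\mu$-integrable. Then $u_t/u_\infty$ and $\Phi(u_t/u_\infty)$ are $\mu$-integrable and $$\mathrm{Ent}_\mu^\Phi\Big(\frac{u_t}{u_\infty}\Big)\le e^{-t/C}\,\mathrm{Ent}_\mu^\Phi\Big(\frac{u_0}{u_\infty}\Big)\qquad\text{for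 all }t\ge0,$$ and $u_t$ converges to $u_\infty$ in $\Phi$-entropy: $\mathrm{Ent}_\mu^\Phi(u_t/u_\infty)\to0$ as $t\to\infty$. (The total mass $\int u_t\,dx$ need not be $1$; when it differs from $1$, convergence means exactly that this entropy tends to $0$.) -/

import Mathlib

open MeasureTheory ProbabilityTheory Filter Topology
open scoped NNReal ENNReal ContDiff

noncomputable section

namespace FokkerPlanck

/-- The Euclidean space `ℝⁿ`. -/
abbrev Space (n : ℕ) : Type := EuclideanSpace ℝ (Fin n)

/-- The divergence `∑ᵢ ∂ᵢ Fᵢ` of a vector field on `ℝⁿ`. -/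
def divergence {n : ℕ} (F : Space n → Space n) (x : Space n) : ℝ :=
  ∑ i : Fin n, fderiv ℝ (fun y => F y i) x (EuclideanSpace.single i 1)

/-- The vector field `x ↦ D(x) v(x)`. -/
def mulField {n : ℕ} (D : Space n → Matrix (Fin n) (Fin n) ℝ) (v : Space n → Space n) :
    Space n → Space n :=
  fun x => Matrix.toEuclideanLin (D x) (v x)

/-- The diffusion operator `L f = div (D ∇f) - ⟨D a, ∇f⟩`. -/
def diffusionOp {n : ℕ} (D : Space n → Matrix (Fin n) (Fin n) ℝ) (a : Space n → Space n)
    (f : Space n → ℝ) (x : Space n) : ℝ :=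
  divergence (mulField D (gradient f)) x - inner ℝ (mulField D a x) (gradient f x)

/-- The Fokker-Planck operator `v ↦ div [D (∇v + v a)]`. -/
def fokkerPlanckOp {n : ℕ} (D : Space n → Matrix (Fin n) (Fin n) ℝ) (a : Space n → Space n)
    (v : Space n → ℝ) (x : Space n) : ℝ :=
  divergence (mulField D (fun y => gradient v y + v y • a y)) x

/-- The carré du champ `Γ(f) = (L(f²) - 2 f L f) / 2` of the operator `L`. -/
def carreDuChamp {n : ℕ} (D : Space n → Matrix (Fin n) (Fin n) ℝ) (a : Space n → Space n)
    (f : Space n → ℝ) (x : Space n) : ℝ :=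
  (diffusionOp D a (fun y => f y ^ 2) x - 2 * f x * diffusionOp D a f x) / 2

/-- A Markov semigroup on `ℝⁿ`, given by its transition kernels `p_t(x, dy)`. -/
structure MarkovSemigroup (n : ℕ) where
  kernel : ℝ≥0 → Kernel (Space n) (Space n)
  isMarkov : ∀ t, IsMarkovKernel (kernel t)
  kernel_zero : kernel 0 = Kernel.id
  kernel_add : ∀ s t, kernel (s + t) = kernel t ∘ₖ kernel s

/-- The action `P_t f (x) = ∫ f(y) p_t(x, dy)`. -/
def MarkovSemigroup.act {n : ℕ} (P : MarkovSemigroup n) (t : ℝ≥0) (f : Space n → ℝ)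
    (x : Space n) : ℝ :=
  ∫ y, f y ∂(P.kernel t x)

/-- `f` is in the domain of the infinitesimal generator `∂P_t/∂t` at `t = 0⁺`, with image `g`:
`f` is a bounded Borel function and `(P_t f - f) / t → g` boundedly and pointwise as `t → 0⁺`. -/
structure MarkovSemigroup.InGenerator {n : ℕ} (P : MarkovSemigroup n) (f g : Space n → ℝ) :
    Prop where
  measurable : Measurable f
  bounded : ∃ M : ℝ, ∀ x, |f x| ≤ M
  bounded_quotient : ∃ M : ℝ, ∀ t : ℝ≥0, 0 < t → ∀ x, |(P.act t f x - f x) / (t : ℝ)| ≤ M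
  tendsto : ∀ x, Tendsto (fun t : ℝ≥0 => (P.act t f x - f x) / (t : ℝ)) (𝓝[>] 0) (𝓝 (g x))

/-- The generator of the semigroup is the operator `L f = div (D ∇f) - ⟨D a, ∇f⟩`: it is given by
this formula on smooth compactly supported functions. -/
def MarkovSemigroup.HasDiffusionGenerator {n : ℕ} (P : MarkovSemigroup n)
    (D : Space n → Matrix (Fin n) (Fin n) ℝ) (a : Space n → Space n) : Prop :=
  ∀ f : Space n → ℝ, ContDiff ℝ ∞ f → HasCompactSupport f → P.InGenerator f (diffusionOp D a f)

/-- The measure `v dx` on `ℝⁿ`. -/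
def densityMeasure {n : ℕ} (v : Space n → ℝ) : Measure (Space n) :=
  volume.withDensity (fun x => ENNReal.ofReal (v x))

/-- The `Φ`-entropy `μ(Φ(f)) - Φ(μ(f))`; used only when `f` and `Φ(f)` are `μ`-integrable. -/
def phiEntropy {n : ℕ} (μ : Measure (Space n)) (Φ : ℝ → ℝ) (f : Space n → ℝ) : ℝ :=
  (∫ x, Φ (f x) ∂μ) - Φ (∫ x, f x ∂μ)

/-- The `Φ`-entropy inequality `Ent_μ^Φ(f) ≤ C μ(Φ''(f) Γ(f))` for all `I`-valued functions `f`
of class `C²` with finite entropy. It says nothing if the nonnegative function `Φ''(f) Γ(f)` is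
not integrable, that is, if the right-hand side is infinite. -/
def PhiEntropyInequality {n : ℕ} (D : Space n → Matrix (Fin n) (Fin n) ℝ)
    (a : Space n → Space n) (μ : Measure (Space n)) (I : Set ℝ) (Φ : ℝ → ℝ) (C : ℝ) : Prop :=
  ∀ f : Space n → ℝ, ContDiff ℝ 2 f → (∀ x, f x ∈ I) →
    Integrable f μ → Integrable (fun x => Φ (f x)) μ →
    Integrable (fun x => iteratedDerivWithin 2 Φ I (f x) * carreDuChamp D a f x) μ →
    phiEntropy μ Φ f ≤ C * ∫ x, iteratedDerivWithin 2 Φ I (f x) * carreDuChamp D a f x ∂μ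

/-- `u` solves the Fokker-Planck equation `∂ₜ u = div [D (∇u + u a)]` with initial datum `u 0`,
where the right-hand side is the dual, for the Lebesgue measure, of the generator of `P`.
It is a classical solution at positive times: `u`, `∇u`, `∇²u` are continuous on `(0, ∞) × ℝⁿ` and
the equation (hence continuity of `∂ₜ u`) holds at every point. It is locally bounded in `L¹(dx)`,
and the equation `∂ₜ u = L* u` holds in duality with the domain of the generator; this
fixes the initial datum and the behaviour at infinity, which the pointwise equation leaves open. -/
structure IsSolution {n : ℕ} (D : Space n → Matrix (Fin n) (Fin n) ℝ) (a : Space n → Space n)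
    (P : MarkovSemigroup n) (u : ℝ → Space n → ℝ) : Prop where
  contDiff : ∀ t, 0 < t → ContDiff ℝ 2 (u t)
  continuousOn :
    ContinuousOn (fun p : ℝ × Space n => u p.1 p.2) (Set.Ioi 0 ×ˢ Set.univ)
  continuousOn_fderiv :
    ContinuousOn (fun p : ℝ × Space n => fderiv ℝ (u p.1) p.2) (Set.Ioi 0 ×ˢ Set.univ)
  continuousOn_fderiv_fderiv :
    ContinuousOn (fun p : ℝ × Space n => fderiv ℝ (fderiv ℝ (u p.1)) p.2)
      (Set.Ioi 0 ×ˢ Set.univ)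
  equation : ∀ t, 0 < t → ∀ x, HasDerivAt (fun s => u s x) (fokkerPlanckOp D a (u t) x) t
  integrable : ∀ t, 0 ≤ t → Integrable (u t)
  locally_bounded : ∀ T : ℝ, ∃ M : ℝ, ∀ t, 0 ≤ t → t ≤ T → ∫ x, |u t x| ≤ M
  duality : ∀ f g : Space n → ℝ, P.InGenerator f g → ∀ t, 0 ≤ t →
    (∫ x, f x * u t x) - (∫ x, f x * u 0 x) = ∫ s in (0 : ℝ)..t, ∫ x, g x * u s x

end FokkerPlanck

end

/-! Formally the entropy of `f_t = u_t / uInf` has derivative `-∫ Φ''(f_t) Γ(f_t) dμ`, and the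
entropy inequality closes a Grönwall argument. Differentiating under the integral and integrating by
parts would need control at infinity that is not available, so the proof works with finite time
steps and one-sided estimates.

Duality with the generator forces `∫ P_s w · u_r dx = ∫ w · u_{r+s} dx` for every bounded Borel `w`
(`IsSolution.integral_act_mul`). Under the coupling `μ(dy) p_s(y, dx)`, with second marginal `μ` by
invariance, this says that `f_{t+s}(x)` is the conditional expectation of `f_t(y)` given `x`.
Conditional Jensen then shows that the entropy does not increase, and that over a step `s` it drops
by at least the mean Bregman divergence of `f_t(y)` from `f_{t+s}(x)` (`lintegral_add_bregman_le`).

For small `s` that divergence, divided by `s`, has lower limit at least `Φ''(f_t) Γ(f_t)` at each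
point (`eventually_le_lintegral_bregman`). Only test functions are fed to the generator here, and
Fatou's lemma integrates the bound. The entropy inequality then yields, for each `r < 1/C`,
arbitrarily small steps along which the entropy decays at rate `r` (`IsSolution.exists_step`).
Monotonicity glues these steps together (`le_mul_exp_of_frequently_step`), and `r → 1/C` gives the
rate. -/

namespace FokkerPlanck

/-! ### The semigroup on bounded Borel functions and its generator. -/

namespace MarkovSemigroup

variable {n : ℕ} (P : MarkovSemigroup n)

instance isMarkovKernel_kernel (t : ℝ≥0) : IsMarkovKernel (P.kernel t) := P.isMarkov t

lemma integrable_of_bounded {f : Space n → ℝ} (hf : Measurable f) {M : ℝ}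
    (hM : ∀ x, |f x| ≤ M) (ν : Measure (Space n)) [IsFiniteMeasure ν] : Integrable f ν :=
  Integrable.of_bound hf.aestronglyMeasurable M (Eventually.of_forall hM)

lemma abs_act_le {f : Space n → ℝ} {M : ℝ} (hM : ∀ x, |f x| ≤ M) (t : ℝ≥0) (x : Space n) :
    |P.act t f x| ≤ M := by
  have := norm_integral_le_of_norm_le_const (μ := P.kernel t x) (f := f) (C := M)
    (Eventually.of_forall hM)
  simpa [act] using this

lemma measurable_act {f : Space n → ℝ} (hf : Measurable f) (t : ℝ≥0) :
    Measurable (P.act t f) :=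
  (StronglyMeasurable.integral_kernel (κ := P.kernel t) hf.stronglyMeasurable).measurable

lemma act_zero {f : Space n → ℝ} (hf : Measurable f) : P.act 0 f = f := by
  ext x
  simp [act, P.kernel_zero, Kernel.id_apply, integral_dirac' _ _ hf.stronglyMeasurable]

lemma act_add {f : Space n → ℝ} (hf : Measurable f) {M : ℝ} (hM : ∀ x, |f x| ≤ M)
    (s t : ℝ≥0) (x : Space n) : P.act (s + t) f x = P.act s (P.act t f) x := by
  have h : Integrable f ((P.kernel t ∘ₖ P.kernel s) x) := by
    rw [← P.kernel_add]
    exact integrable_of_bounded hf hM _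
  simp only [act]
  rw [P.kernel_add, Kernel.integral_comp h]

lemma act_sub {f g : Space n → ℝ} (hf : Measurable f) (hg : Measurable g) {M N : ℝ}
    (hM : ∀ x, |f x| ≤ M) (hN : ∀ x, |g x| ≤ N) (t : ℝ≥0) (x : Space n) :
    P.act t (fun y => f y - g y) x = P.act t f x - P.act t g x :=
  integral_sub (integrable_of_bounded hf hM _) (integrable_of_bounded hg hN _)

variable {P}

lemma InGenerator.tendsto_seq {f g : Space n → ℝ} (h : P.InGenerator f g) (x : Space n)
    {ι : Type*} {l : Filter ι} {s : ι → ℝ≥0} (hs : Tendsto s l (𝓝[>] 0)) :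
    Tendsto (fun k => (P.act (s k) f x - f x) / (s k : ℝ)) l (𝓝 (g x)) :=
  (h.tendsto x).comp hs

lemma tendsto_one_div_nnreal :
    Tendsto (fun k : ℕ => (1 / ((k : ℝ≥0) + 1))) atTop (𝓝[>] 0) := by
  refine tendsto_nhdsWithin_iff.2 ⟨tendsto_one_div_add_atTop_nhds_zero_nat, ?_⟩
  exact Eventually.of_forall fun k => by simp only [Set.mem_Ioi]; positivity

lemma InGenerator.measurable_image {f g : Space n → ℝ} (h : P.InGenerator f g) :
    Measurable g :=
  measurable_of_tendsto_metrizable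
    (f := fun k : ℕ => fun x => (P.act (1 / ((k : ℝ≥0) + 1)) f x - f x)
      / ((1 / ((k : ℝ≥0) + 1) : ℝ≥0) : ℝ))
    (fun _ => ((P.measurable_act h.measurable _).sub h.measurable).div_const _)
    (tendsto_pi_nhds.2 fun x => h.tendsto_seq x tendsto_one_div_nnreal)

lemma InGenerator.bounded_image {f g : Space n → ℝ} (h : P.InGenerator f g) :
    ∃ M : ℝ, 0 ≤ M ∧ (∀ x, |g x| ≤ M) ∧ ∀ t : ℝ≥0, ∀ x, |P.act t f x - f x| ≤ M * t := by
  obtain ⟨M, hM⟩ := h.bounded_quotient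
  have hM0 : 0 ≤ M := (abs_nonneg _).trans (hM 1 one_pos 0)
  refine ⟨M, hM0, fun x => ?_, fun t x => ?_⟩
  · refine le_of_tendsto (h.tendsto x).abs ?_
    filter_upwards [self_mem_nhdsWithin] with t ht using hM t ht x
  · rcases eq_or_lt_of_le (zero_le (a := t)) with rfl | ht
    · simp [P.act_zero h.measurable]
    · have := hM t ht x
      have ht' : (0 : ℝ) < t := ht
      rwa [abs_div, abs_of_pos ht', div_le_iff₀ ht'] at this

/-- The generator commutes with the semigroup. -/
lemma InGenerator.act {f g : Space n → ℝ} (h : P.InGenerator f g) (t : ℝ≥0) :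
    P.InGenerator (P.act t f) (P.act t g) := by
  obtain ⟨N, hN⟩ := h.bounded
  obtain ⟨M, hM⟩ := h.bounded_quotient
  have key : ∀ s : ℝ≥0, ∀ x, (P.act s (P.act t f) x - P.act t f x) / (s : ℝ)
      = P.act t (fun y => (P.act s f y - f y) / (s : ℝ)) x := by
    intro s x
    rw [← P.act_add h.measurable hN, add_comm, P.act_add h.measurable hN,
      ← P.act_sub (P.measurable_act h.measurable s) h.measurable (P.abs_act_le hN s) hN]
    exact (integral_div _ _).symm
  refine ⟨P.measurable_act h.measurable t, ⟨N, P.abs_act_le hN t⟩, ⟨M, fun s hs x => ?_⟩,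
    fun x => ?_⟩
  · rw [key]
    exact P.abs_act_le (hM s hs) t x
  · simp_rw [key]
    refine tendsto_integral_filter_of_dominated_convergence (fun _ => M) ?_ ?_
      (integrable_const M) (Eventually.of_forall fun y => h.tendsto y)
    · exact Eventually.of_forall fun s =>
        (((P.measurable_act h.measurable s).sub h.measurable).div_const _).aestronglyMeasurable
    · filter_upwards [self_mem_nhdsWithin] with s hs
      exact Eventually.of_forall fun y => hM s hs y

/-- Inserted in the duality relation, constants give conservation of the total mass of the solution.
-/
lemma inGenerator_const (c : ℝ) : P.InGenerator (fun _ => c) (fun _ => 0) := by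
  refine ⟨measurable_const, ⟨|c|, fun _ => le_rfl⟩, ⟨0, fun t _ x => ?_⟩, fun x => ?_⟩ <;>
  simp [MarkovSemigroup.act]

lemma InGenerator.abs_act_sub_act_le {f g : Space n → ℝ} (h : P.InGenerator f g) :
    ∃ M : ℝ, 0 ≤ M ∧ (∀ x, |g x| ≤ M) ∧
      ∀ s t : ℝ≥0, s ≤ t → ∀ x, |P.act t f x - P.act s f x| ≤ M * (t - s) := by
  obtain ⟨M, hM0, hMg, hM⟩ := h.bounded_image
  obtain ⟨N, hN⟩ := h.bounded
  refine ⟨M, hM0, hMg, fun s t hst x => ?_⟩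
  obtain ⟨r, rfl⟩ := exists_add_of_le hst
  rw [P.act_add h.measurable hN,
    ← P.act_sub (P.measurable_act h.measurable r) h.measurable (P.abs_act_le hN r) hN]
  simpa using P.abs_act_le (fun y => hM r y) s x

/-- Second order expansion of the semigroup on the domain of the square of the generator. -/
lemma InGenerator.abs_act_sub_linear_le {f g g' : Space n → ℝ} (h : P.InGenerator f g)
    (h' : P.InGenerator g g') :
    ∃ M : ℝ, 0 ≤ M ∧ ∀ t : ℝ≥0, ∀ x, |P.act t f x - f x - t * g x| ≤ M * (t : ℝ) ^ 2 := by
  obtain ⟨N, hN0, hNg, hN⟩ := h.abs_act_sub_act_le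
  obtain ⟨M, hM0, -, hM⟩ := h'.bounded_image
  obtain ⟨K, hK⟩ := h.bounded
  refine ⟨M / 2, by positivity, fun t x => ?_⟩
  -- The generator only provides a right derivative; with continuity in time, this is enough for the
  -- mean value inequality used below with boundary `M / 2 * r ^ 2`.
  have hderiv : ∀ s : ℝ, 0 ≤ s → HasDerivWithinAt (fun r : ℝ => P.act r.toNNReal f x)
      (P.act s.toNNReal g x) (Set.Ici s) s := by
    intro s hs
    rw [← hasDerivWithinAt_Ioi_iff_Ici, hasDerivWithinAt_iff_tendsto_slope' (by simp)]
    have hlim : Tendsto (fun r : ℝ => (r - s).toNNReal) (𝓝[>] s) (𝓝[>] 0) := by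
      refine tendsto_nhdsWithin_iff.2 ⟨?_, ?_⟩
      · have : Continuous fun r : ℝ => (r - s).toNNReal := by fun_prop
        have h0 := this.tendsto s
        simp only [sub_self, Real.toNNReal_zero] at h0
        exact h0.mono_left nhdsWithin_le_nhds
      · filter_upwards [self_mem_nhdsWithin] with r hr
        simpa using hr
    refine ((h.act s.toNNReal).tendsto_seq x hlim).congr' ?_
    filter_upwards [self_mem_nhdsWithin] with r hr
    have hr' : 0 ≤ r - s := sub_nonneg.2 (le_of_lt hr)
    rw [← P.act_add h.measurable hK, ← Real.toNNReal_add hr' hs, Real.coe_toNNReal _ hr',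
      slope_def_field, sub_add_cancel]
  have hcont : Continuous (fun r : ℝ => P.act r.toNNReal f x) := by
    have : LipschitzWith N.toNNReal (fun r : ℝ≥0 => P.act r f x) := by
      refine LipschitzWith.of_dist_le_mul fun s r => ?_
      rw [Real.coe_toNNReal _ hN0, Real.dist_eq, NNReal.dist_eq]
      rcases le_total s r with hsr | hsr
      · rw [abs_sub_comm, abs_sub_comm (s : ℝ), abs_of_nonneg (a := (r : ℝ) - s)
          (sub_nonneg.2 hsr)]
        exact hN s r hsr x
      · rw [abs_of_nonneg (a := (s : ℝ) - r) (sub_nonneg.2 hsr)]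
        exact hN r s hsr x
    exact this.continuous.comp continuous_real_toNNReal
  have := image_norm_le_of_norm_deriv_right_le_deriv_boundary (a := 0) (b := t)
    (f := fun r : ℝ => P.act r.toNNReal f x - f x - r * g x)
    (f' := fun r => P.act r.toNNReal g x - g x) (B := fun r => M / 2 * r ^ 2) (B' := fun r => M * r)
    (by fun_prop) (fun r hr => by
      simpa using ((hderiv r hr.1).sub_const (f x)).fun_sub
        ((hasDerivWithinAt_id r (Set.Ici r)).mul_const (g x)))
    (by simp [P.act_zero h.measurable])
    (fun r => by
      have := ((hasDerivAt_id r).pow 2).const_mul (M / 2)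
      refine this.congr_deriv ?_
      simp; ring)
    (fun r hr => by
      have := hM r.toNNReal x
      rwa [Real.coe_toNNReal _ hr.1] at this)
    (x := (t : ℝ)) ⟨t.2, le_rfl⟩
  simpa using this

end MarkovSemigroup

/-! ### Test functions are stable under the diffusion operator. -/

variable {n : ℕ}

lemma contDiff_mulField_apply {D : Space n → Matrix (Fin n) (Fin n) ℝ}
    (hD : ∀ i j, ContDiff ℝ ∞ (fun x => D x i j)) {v : Space n → Space n} {k : WithTop ℕ∞}
    (hk : k ≤ (∞ : WithTop ℕ∞)) (hv : ContDiff ℝ k v) : ContDiff ℝ k (mulField D v) := by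
  rw [contDiff_euclidean]
  intro i
  have : (fun x => mulField D v x i) = fun x => ∑ j, D x i j * v x j := by
    ext x
    simp [mulField, Matrix.toLpLin_apply, Matrix.mulVec, dotProduct]
  rw [this]
  exact ContDiff.sum fun j _ => ((hD i j).of_le hk).mul (contDiff_euclidean.1 hv j)

lemma contDiff_divergence {F : Space n → Space n} {k m : WithTop ℕ∞} (hF : ContDiff ℝ m F)
    (hk : k + 1 ≤ m) : ContDiff ℝ k (divergence F) :=
  ContDiff.sum fun i _ => ((contDiff_euclidean.1 hF i).fderiv_right hk).clm_apply contDiff_const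

lemma contDiff_gradient {f : Space n → ℝ} {k m : WithTop ℕ∞} (hf : ContDiff ℝ m f)
    (hk : k + 1 ≤ m) : ContDiff ℝ k (gradient f) :=
  ((InnerProductSpace.toDual ℝ (Space n)).symm.contDiff).comp (hf.fderiv_right hk)

lemma contDiff_diffusionOp {D : Space n → Matrix (Fin n) (Fin n) ℝ} {a : Space n → Space n}
    (hD : ∀ i j, ContDiff ℝ ∞ (fun x => D x i j)) (ha : ContDiff ℝ ∞ a) {f : Space n → ℝ}
    (hf : ContDiff ℝ ∞ f) : ContDiff ℝ ∞ (diffusionOp D a f) := by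
  have hg : ContDiff ℝ ∞ (gradient f) := contDiff_gradient hf (by simp)
  exact (contDiff_divergence (contDiff_mulField_apply hD le_rfl hg) (by simp)).sub
    ((contDiff_mulField_apply hD le_rfl ha).inner ℝ hg)

/-- Together with smoothness this makes `L f` a test function again, so test functions lie in the
domain of the square of the generator. -/
lemma hasCompactSupport_diffusionOp {D : Space n → Matrix (Fin n) (Fin n) ℝ}
    {a : Space n → Space n} {f : Space n → ℝ} (hf : HasCompactSupport f) :
    HasCompactSupport (diffusionOp D a f) := by
  refine HasCompactSupport.of_support_subset_isCompact hf ?_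
  intro x hx
  by_contra hx'
  refine hx ?_
  have h0 : f =ᶠ[𝓝 x] fun _ => 0 := notMem_tsupport_iff_eventuallyEq.1 hx'
  have h1 : ∀ᶠ y in 𝓝 x, gradient f y = 0 := by
    filter_upwards [h0.eventuallyEq_nhds] with y hy
    simp [gradient, hy.fderiv_eq]
  have h2 : divergence (mulField D (gradient f)) x = 0 := by
    refine Finset.sum_eq_zero fun i _ => ?_
    have : (fun y => mulField D (gradient f) y i) =ᶠ[𝓝 x] fun _ => 0 := by
      filter_upwards [h1] with y hy
      simp [mulField, hy]
    simp [this.fderiv_eq]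
  simp [diffusionOp, h2, h1.self_of_nhds]

/-- Quadratic increments force a zero derivative. The estimate replaces differentiating a duality
pairing in which both factors depend on time. -/
lemma eq_of_abs_sub_le_sq {φ : ℝ → ℝ} {K s : ℝ} (hs : 0 ≤ s)
    (h : ∀ x y, 0 ≤ x → x ≤ y → y ≤ s → |φ y - φ x| ≤ K * (y - x) ^ 2) : φ s = φ 0 := by
  have hsym : ∀ x ∈ Set.Icc 0 s, ∀ y ∈ Set.Icc 0 s, |φ y - φ x| ≤ K * (y - x) ^ 2 := by
    intro x hx y hy
    rcases le_total x y with hxy | hxy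
    · exact h x y hx.1 hxy hy.2
    · rw [abs_sub_comm, show (y - x) ^ 2 = (x - y) ^ 2 by ring]
      exact h y x hy.1 hxy hx.2
  have hd : ∀ x ∈ Set.Icc 0 s, HasDerivWithinAt φ 0 (Set.Icc 0 s) x := by
    intro x hx
    have hO : (fun y => φ y - φ x) =O[𝓝[Set.Icc 0 s] x] fun y => ‖y - x‖ ^ 2 := by
      refine Asymptotics.IsBigO.of_bound K ?_
      filter_upwards [self_mem_nhdsWithin] with y hy
      simpa using hsym x hx y hy
    have := (hO.hasFDerivWithinAt hx one_lt_two).hasDerivWithinAt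
    simpa using this.add_const (φ x)
  have hcont : ContinuousOn φ (Set.Icc 0 s) := fun x hx => (hd x hx).continuousWithinAt
  refine constant_of_derivWithin_zero (fun x hx => (hd x hx).differentiableWithinAt)
    (fun x hx => ?_) s ⟨hs, le_rfl⟩
  have hs' : (0 : ℝ) < s := hx.1.trans_lt hx.2
  exact (hd x ⟨hx.1, hx.2.le⟩).derivWithin (uniqueDiffOn_Icc hs' x ⟨hx.1, hx.2.le⟩)

/-! ### Propagation of the solution by the semigroup, on test functions. -/

namespace IsSolution

variable {D : Space n → Matrix (Fin n) (Fin n) ℝ} {a : Space n → Space n}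
  {P : MarkovSemigroup n} {u : ℝ → Space n → ℝ}

lemma integrable_mul (hu : IsSolution D a P u) {g : Space n → ℝ} (hg : Measurable g) {M : ℝ}
    (hM : ∀ x, |g x| ≤ M) {t : ℝ} (ht : 0 ≤ t) : Integrable (fun x => g x * u t x) :=
  (hu.integrable t ht).bdd_mul hg.aestronglyMeasurable (Eventually.of_forall hM)

lemma abs_integral_mul_le (hu : IsSolution D a P u) {g : Space n → ℝ} {M N t : ℝ}
    (hM0 : 0 ≤ M) (hM : ∀ x, |g x| ≤ M) (ht : 0 ≤ t)
    (hN : ∫ x, |u t x| ≤ N) : |∫ x, g x * u t x| ≤ M * N := by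
  have h1 : |∫ x, g x * u t x| ≤ ∫ x, M * |u t x| := by
    refine norm_integral_le_of_norm_le (f := fun x => g x * u t x)
      ((hu.integrable t ht).abs.const_mul M)
      (Eventually.of_forall fun x => ?_)
    rw [Real.norm_eq_abs, abs_mul]
    exact mul_le_mul_of_nonneg_right (hM x) (abs_nonneg _)
  rw [integral_const_mul] at h1
  exact h1.trans (mul_le_mul_of_nonneg_left hN hM0)

lemma aestronglyMeasurable_integral_mul (hu : IsSolution D a P u) {g : Space n → ℝ}
    (hg : Measurable g) :
    AEStronglyMeasurable (fun s => ∫ x, g x * u s x) (volume.restrict (Set.Ioi 0)) := by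
  have h1 : AEStronglyMeasurable (fun p : ℝ × Space n => u p.1 p.2)
      ((volume.restrict (Set.Ioi 0)).prod volume) := by
    have := hu.continuousOn.aestronglyMeasurable (μ := (volume : Measure ℝ).prod volume)
      (measurableSet_Ioi.prod MeasurableSet.univ)
    rwa [← Measure.prod_restrict, Measure.restrict_univ] at this
  have h2 : AEStronglyMeasurable (fun p : ℝ × Space n => g p.2 * u p.1 p.2)
      ((volume.restrict (Set.Ioi 0)).prod volume) :=
    (hg.comp measurable_snd).aestronglyMeasurable.mul h1
  exact h2.integral_prod_right'

lemma intervalIntegrable_integral_mul (hu : IsSolution D a P u) {g : Space n → ℝ}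
    (hg : Measurable g) {M : ℝ} (hM : ∀ x, |g x| ≤ M) {r t : ℝ} (hr : 0 ≤ r) (hrt : r ≤ t) :
    IntervalIntegrable (fun s => ∫ x, g x * u s x) volume r t := by
  obtain ⟨N, hN⟩ := hu.locally_bounded t
  rw [intervalIntegrable_iff_integrableOn_Ioc_of_le hrt]
  have hM0 : 0 ≤ M := (abs_nonneg _).trans (hM 0)
  have : IsFiniteMeasure (volume.restrict (Set.Ioc r t)) := ⟨by simp⟩
  refine Integrable.of_bound ((hu.aestronglyMeasurable_integral_mul hg).mono_measure
    (Measure.restrict_mono (fun s hs => hr.trans_lt hs.1) le_rfl)) (M * N) ?_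
  filter_upwards [ae_restrict_mem measurableSet_Ioc] with s hs
  have hs0 : 0 ≤ s := hr.trans hs.1.le
  exact hu.abs_integral_mul_le hM0 hM hs0 (hN s hs0 hs.2)

lemma duality_interval (hu : IsSolution D a P u) {f g : Space n → ℝ} (h : P.InGenerator f g)
    {r t : ℝ} (hr : 0 ≤ r) (hrt : r ≤ t) :
    (∫ x, f x * u t x) - (∫ x, f x * u r x) = ∫ s in r..t, ∫ x, g x * u s x := by
  obtain ⟨M, -, hM, -⟩ := h.bounded_image
  have ht := hu.duality f g h t (hr.trans hrt)
  have hr' := hu.duality f g h r hr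
  rw [← intervalIntegral.integral_add_adjacent_intervals
    (hu.intervalIntegrable_integral_mul h.measurable_image hM le_rfl hr)
    (hu.intervalIntegrable_integral_mul h.measurable_image hM hr hrt)] at ht
  linarith

lemma abs_duality_sub_le (hu : IsSolution D a P u) {f g : Space n → ℝ} (h : P.InGenerator f g)
    {M N r t : ℝ} (hM0 : 0 ≤ M) (hM : ∀ x, |g x| ≤ M) (hr : 0 ≤ r) (hrt : r ≤ t)
    (hN : ∀ s, 0 ≤ s → s ≤ t → ∫ x, |u s x| ≤ N) :
    |(∫ x, f x * u t x) - ∫ x, f x * u r x| ≤ M * N * (t - r) := by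
  rw [hu.duality_interval h hr hrt]
  have := intervalIntegral.norm_integral_le_of_norm_le_const (a := r) (b := t) (C := M * N)
    (f := fun s => ∫ x, g x * u s x) (fun s hs => by
      rw [Set.uIoc_of_le hrt] at hs
      have hs0 : 0 ≤ s := hr.trans hs.1.le
      exact hu.abs_integral_mul_le hM0 hM hs0 (hN s hs0 hs.2))
  rwa [Real.norm_eq_abs, abs_of_nonneg (sub_nonneg.2 hrt)] at this

/-- Since `g` is itself in the domain, `s ↦ ∫ g u_s` is Lipschitz; integrating its variation over
`[r, t]` leaves a quadratic remainder. -/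
lemma abs_duality_sub_linear_le (hu : IsSolution D a P u) {f g g' : Space n → ℝ}
    (h : P.InGenerator f g) (h' : P.InGenerator g g')
    {M N r t : ℝ} (hM0 : 0 ≤ M) (hM : ∀ x, |g' x| ≤ M) (hr : 0 ≤ r) (hrt : r ≤ t)
    (hN : ∀ s, 0 ≤ s → s ≤ t → ∫ x, |u s x| ≤ N) :
    |(∫ x, f x * u t x) - (∫ x, f x * u r x) - (t - r) * ∫ x, g x * u r x|
      ≤ M * N * (t - r) ^ 2 := by
  obtain ⟨K, -, hK, -⟩ := h.bounded_image
  have hN0 : 0 ≤ N := (integral_nonneg fun _ => abs_nonneg _).trans (hN t (hr.trans hrt) le_rfl)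
  have hc : (t - r) * ∫ x, g x * u r x = ∫ _ in r..t, ∫ x, g x * u r x := by simp
  rw [hu.duality_interval h hr hrt, hc, ← intervalIntegral.integral_sub
    (hu.intervalIntegrable_integral_mul h.measurable_image hK hr hrt) intervalIntegrable_const]
  have := intervalIntegral.norm_integral_le_of_norm_le_const (a := r) (b := t)
    (C := M * N * (t - r))
    (f := fun s => (∫ x, g x * u s x) - ∫ x, g x * u r x) (fun s hs => by
      rw [Set.uIoc_of_le hrt] at hs
      refine (hu.abs_duality_sub_le h' hM0 hM hr hs.1.le
        (fun σ h0 hσ => hN σ h0 (hσ.trans hs.2))).trans ?_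
      exact mul_le_mul_of_nonneg_left (by linarith [hs.2]) (mul_nonneg hM0 hN0))
  rw [Real.norm_eq_abs, abs_of_nonneg (sub_nonneg.2 hrt)] at this
  linarith

/-- The solution is propagated by the semigroup: duality with a function in the domain of the
square of the generator. -/
lemma integral_act_mul_of_inGenerator (hu : IsSolution D a P u) {f g g' : Space n → ℝ}
    (h : P.InGenerator f g) (h' : P.InGenerator g g') {r : ℝ} (hr : 0 ≤ r) (s : ℝ≥0) :
    ∫ x, P.act s f x * u r x = ∫ x, f x * u (r + s) x := by
  obtain ⟨N, hN⟩ := hu.locally_bounded (r + s)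
  obtain ⟨M, hM0, hM, -⟩ := h'.bounded_image
  obtain ⟨K, hK0, hK⟩ := h.abs_act_sub_linear_le h'
  obtain ⟨A, hA⟩ := h.bounded
  obtain ⟨B, hB⟩ := h'.bounded
  have hexp : ∀ τ δ : ℝ≥0, ∀ x,
      |P.act (τ + δ) f x - P.act τ f x - δ * P.act τ g x| ≤ K * (δ : ℝ) ^ 2 := by
    intro τ δ x
    have e : P.act (τ + δ) f x - P.act τ f x - δ * P.act τ g x
        = P.act τ (fun y => (P.act δ f y - f y) - δ * g y) x := by
      rw [P.act_sub (f := fun y => P.act δ f y - f y) (g := fun y => δ * g y) (M := A + A) (N := δ * B)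
        ((P.measurable_act h.measurable δ).sub h.measurable) (h'.measurable.const_mul _) (fun y => (abs_sub _ _).trans
          (add_le_add (P.abs_act_le hA δ y) (hA y)))
        (fun y => by
          rw [abs_mul, NNReal.abs_eq]
          exact mul_le_mul_of_nonneg_left (hB y) δ.2),
        P.act_sub (P.measurable_act h.measurable δ) h.measurable (P.abs_act_le hA δ) hA,
        P.act_add h.measurable hA]
      congr 1
      exact (integral_const_mul _ _).symm
    rw [e]
    exact P.abs_act_le (fun y => hK δ y) τ x
  -- Interpolation between the two sides: `σ ↦ ∫ P_{s-σ} f · u_{r+σ}`. Over an increment `δ`, moving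
  -- time in `u` (`e1`) and in the semigroup (`e2`) produces the same first-order term `δ ∫ P_τ g ·
  -- u_{r+σ}`; it cancels and only `δ ^ 2` terms remain.
  have hφ := eq_of_abs_sub_le_sq (K := M * N + K * N) (NNReal.coe_nonneg s)
    (φ := fun σ => ∫ x, P.act (s - σ.toNNReal) f x * u (r + σ) x) (by
      intro σ σ' h0 hσ hσ'
      set τ : ℝ≥0 := s - σ'.toNNReal with hτ
      set δ : ℝ≥0 := (σ' - σ).toNNReal with hδ
      have hδc : (δ : ℝ) = σ' - σ := Real.coe_toNNReal _ (sub_nonneg.2 hσ)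
      have hτδ : s - σ.toNNReal = τ + δ := by
        have h1 : σ.toNNReal ≤ s := Real.toNNReal_le_iff_le_coe.2 (hσ.trans hσ')
        have h2 : σ'.toNNReal ≤ s := Real.toNNReal_le_iff_le_coe.2 hσ'
        apply NNReal.coe_injective
        rw [NNReal.coe_add, hτ, NNReal.coe_sub h1, NNReal.coe_sub h2, hδc,
          Real.coe_toNNReal _ h0, Real.coe_toNNReal _ (h0.trans hσ)]
        ring
      have hρ : 0 ≤ r + σ := by positivity
      have e1 := hu.abs_duality_sub_linear_le (h.act τ) (h'.act τ) (t := r + σ') hM0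
        (P.abs_act_le hM τ) hρ (by linarith) (fun ρ h0 hρ' => hN ρ h0 (by
          have : σ' ≤ s := hσ'
          linarith))
      have e2 : |(∫ x, P.act (τ + δ) f x * u (r + σ) x) - (∫ x, P.act τ f x * u (r + σ) x)
          - δ * ∫ x, P.act τ g x * u (r + σ) x| ≤ K * (δ : ℝ) ^ 2 * N := by
        have i1 := hu.integrable_mul (P.measurable_act h.measurable (τ + δ))
          (P.abs_act_le hA (τ + δ)) hρ
        have i2 := hu.integrable_mul (P.measurable_act h.measurable τ) (P.abs_act_le hA τ) hρ
        have i3 := hu.integrable_mul (P.measurable_act h'.measurable τ) (P.abs_act_le hB τ) hρ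
        have i12 : Integrable (fun x => P.act (τ + δ) f x * u (r + σ) x
            - P.act τ f x * u (r + σ) x) := i1.sub i2
        rw [← integral_const_mul, ← integral_sub i1 i2, ← integral_sub i12 (i3.const_mul _)]
        refine le_of_eq_of_le ?_ (hu.abs_integral_mul_le (by positivity) (hexp τ δ) hρ
          (hN _ hρ (by
            have : σ' ≤ s := hσ'
            linarith)))
        congr 2
        ext x
        ring
      have e3 : r + σ' - (r + σ) = δ := by rw [hδc]; ring
      rw [e3] at e1
      simp only [hτδ]
      rw [← hδc]
      rw [abs_le] at e1 e2 ⊢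
      constructor <;> linarith [e1.1, e1.2, e2.1, e2.2])
  simp only [Real.toNNReal_coe, tsub_self, Real.toNNReal_zero, tsub_zero, add_zero,
    P.act_zero h.measurable] at hφ
  exact hφ.symm

lemma integral_act_mul_of_contDiff (hu : IsSolution D a P u)
    (hD : ∀ i j, ContDiff ℝ ∞ (fun x => D x i j)) (ha : ContDiff ℝ ∞ a)
    (hP : P.HasDiffusionGenerator D a) {f : Space n → ℝ} (hf : ContDiff ℝ ∞ f)
    (hfc : HasCompactSupport f) {r : ℝ} (hr : 0 ≤ r) (s : ℝ≥0) :
    ∫ x, P.act s f x * u r x = ∫ x, f x * u (r + s) x :=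
  hu.integral_act_mul_of_inGenerator (hP f hf hfc)
    (hP _ (contDiff_diffusionOp hD ha hf) (hasCompactSupport_diffusionOp hfc)) hr s

lemma integral_eq (hu : IsSolution D a P u) {t : ℝ} (ht : 0 ≤ t) :
    ∫ x, u t x = ∫ x, u 0 x := by
  have := hu.duality _ _ (MarkovSemigroup.inGenerator_const 1) t ht
  simpa [sub_eq_zero] using this

end IsSolution

/-! ### From test functions to bounded Borel functions. -/

lemma integral_comp_kernel {κ : Kernel (Space n) (Space n)} {ν : Measure (Space n)}
    [IsMarkovKernel κ] [IsFiniteMeasure ν] {f : Space n → ℝ} (hf : Measurable f) {M : ℝ}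
    (hM : ∀ x, |f x| ≤ M) : ∫ x, f x ∂(κ ∘ₘ ν) = ∫ x, ∫ y, f y ∂(κ x) ∂ν := by
  have h := MarkovSemigroup.integrable_of_bounded hf hM (κ ∘ₘ ν)
  rw [Measure.comp_eq_comp_const_apply] at h ⊢
  rw [Kernel.integral_comp h, Kernel.const_apply]

lemma isFiniteMeasure_densityMeasure {w : Space n → ℝ} (hw : Integrable w) :
    IsFiniteMeasure (densityMeasure w) :=
  isFiniteMeasure_withDensity_ofReal hw.2

lemma integral_densityMeasure {w : Space n → ℝ} (hw : AEMeasurable w) (f : Space n → ℝ) :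
    ∫ x, f x ∂(densityMeasure w) = ∫ x, f x * max (w x) 0 := by
  rw [densityMeasure, integral_withDensity_eq_integral_toReal_smul₀ hw.ennreal_ofReal
    (Eventually.of_forall fun _ => ENNReal.ofReal_lt_top)]
  simp [ENNReal.toReal_ofReal', mul_comm]

lemma integral_densityMeasure_sub_neg {w : Space n → ℝ} (hw : Integrable w) {f : Space n → ℝ}
    (hf : Measurable f) {M : ℝ} (hM : ∀ x, |f x| ≤ M) :
    (∫ x, f x ∂(densityMeasure w)) - ∫ x, f x ∂(densityMeasure fun x => -w x)
      = ∫ x, f x * w x := by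
  have hfb : ∀ᵐ x : Space n, ‖f x‖ ≤ M := Eventually.of_forall hM
  rw [integral_densityMeasure hw.aemeasurable, integral_densityMeasure (w := fun x => -w x) hw.neg.aemeasurable,
    ← integral_sub (hw.pos_part.bdd_mul hf.aestronglyMeasurable hfb)
      (hw.neg_part.bdd_mul hf.aestronglyMeasurable hfb)]
  congr 1
  ext x
  rw [← mul_sub]
  congr 1
  rcases le_total (w x) 0 with h | h
  · rw [max_eq_right h, max_eq_left (by linarith)]; ring
  · rw [max_eq_left h, max_eq_right (by linarith)]; ring

/-- A finite measure on `ℝⁿ` is determined by the integrals of test functions. -/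
lemma measure_ext_of_integral_contDiff {m₁ m₂ : Measure (Space n)} [IsFiniteMeasure m₁]
    [IsFiniteMeasure m₂] (huniv : m₁ Set.univ = m₂ Set.univ)
    (h : ∀ f : Space n → ℝ, ContDiff ℝ ∞ f → HasCompactSupport f →
      ∫ x, f x ∂m₁ = ∫ x, f x ∂m₂) : m₁ = m₂ := by
  refine ext_of_generate_finite {s : Set (Space n) | IsOpen s}
    (BorelSpace.measurable_eq.trans rfl) isPiSystem_isOpen (fun U hU => ?_) huniv
  replace hU : IsOpen U := hU
  obtain ⟨f, hf_supp, hf, hf_range⟩ := IsOpen.exists_contDiff_support_eq (n := ⊤) hU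
  have hf01 : ∀ x, 0 ≤ f x ∧ f x ≤ 1 := fun x => hf_range ⟨x, rfl⟩
  let χ : ℕ → ContDiffBump (0 : Space n) := fun k => ⟨k + 1, k + 2, by positivity, by linarith⟩
  -- Since `f` is positive exactly on `U`, `(1 - f) ^ k` tends to `0` on `U` and equals `1`
  -- elsewhere, while `χ k` is `1` on the ball of radius `k + 1`. Hence `F k` tends boundedly to the
  -- indicator of `U`.
  let F : ℕ → Space n → ℝ := fun k x => χ k x * (1 - (1 - f x) ^ k)
  have hF : ∀ k, ContDiff ℝ ∞ (F k) := fun k =>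
    (χ k).contDiff.mul (contDiff_const.sub ((contDiff_const.sub hf).pow k))
  have hFc : ∀ k, HasCompactSupport (F k) := fun k => (χ k).hasCompactSupport.mul_right
  have hpow : ∀ k x, 0 ≤ (1 - f x) ^ k ∧ (1 - f x) ^ k ≤ 1 := fun k x =>
    ⟨pow_nonneg (by linarith [hf01 x]) k,
      pow_le_one₀ (by linarith [hf01 x]) (by linarith [hf01 x])⟩
  have hFb : ∀ k x, |F k x| ≤ 1 := fun k x => by
    have h1 := hpow k x
    have h2 := (χ k).nonneg (x := x)
    have h3 := (χ k).le_one (x := x)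
    rw [abs_of_nonneg (mul_nonneg h2 (by linarith))]
    exact mul_le_one₀ h3 (by linarith) (by linarith)
  have hFlim : ∀ x, Tendsto (fun k => F k x) atTop (𝓝 (U.indicator (fun _ => (1 : ℝ)) x)) := by
    intro x
    have hχ : ∀ᶠ k : ℕ in atTop, χ k x = 1 := by
      obtain ⟨K, hK⟩ := exists_nat_ge ‖x‖
      filter_upwards [eventually_ge_atTop K] with k hk
      refine (χ k).one_of_mem_closedBall ?_
      have : (K : ℝ) ≤ k := by exact_mod_cast hk
      have h1 : (χ k).rIn = k + 1 := rfl
      rw [mem_closedBall_zero_iff, h1]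
      linarith
    by_cases hx : x ∈ U
    · rw [Set.indicator_of_mem hx]
      have hfx : 0 < f x := lt_of_le_of_ne (hf01 x).1 (by
        rw [← hf_supp] at hx
        exact fun h => hx h.symm)
      have := (tendsto_pow_atTop_nhds_zero_of_lt_one (r := 1 - f x) (by linarith [hf01 x])
        (by linarith)).const_sub 1
      rw [sub_zero] at this
      refine this.congr' ?_
      filter_upwards [hχ] with k hk
      simp [F, hk]
    · rw [Set.indicator_of_notMem hx]
      have hfx : f x = 0 := by
        rw [← hf_supp] at hx
        exact Function.notMem_support.1 hx
      simp [F, hfx]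
  have hlim : ∀ m : Measure (Space n), IsFiniteMeasure m →
      Tendsto (fun k => ∫ x, F k x ∂m) atTop (𝓝 (m.real U)) := by
    intro m _
    have := tendsto_integral_of_dominated_convergence (μ := m) (F := F)
      (f := U.indicator (fun _ => (1 : ℝ))) (fun _ => 1)
      (fun k => (hF k).continuous.aestronglyMeasurable) (integrable_const 1)
      (fun k => Eventually.of_forall (hFb k)) (Eventually.of_forall hFlim)
    rwa [integral_indicator_const _ hU.measurableSet, smul_eq_mul, mul_one] at this
  have := tendsto_nhds_unique (hlim m₁ inferInstance)
    ((hlim m₂ inferInstance).congr fun k => (h _ (hF k) (hFc k)).symm)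
  exact (measureReal_eq_measureReal_iff).1 this

/-- The solution is propagated by the semigroup. -/
lemma IsSolution.integral_act_mul {D : Space n → Matrix (Fin n) (Fin n) ℝ}
    {a : Space n → Space n} {P : MarkovSemigroup n} {u : ℝ → Space n → ℝ}
    (hu : IsSolution D a P u)
    (hD : ∀ i j, ContDiff ℝ ∞ (fun x => D x i j)) (ha : ContDiff ℝ ∞ a)
    (hP : P.HasDiffusionGenerator D a) {f : Space n → ℝ} (hf : Measurable f) {M : ℝ}
    (hM : ∀ x, |f x| ≤ M) {r : ℝ} (hr : 0 ≤ r) (s : ℝ≥0) :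
    ∫ x, P.act s f x * u r x = ∫ x, f x * u (r + s) x := by
  have hrs : 0 ≤ r + s := by positivity
  have h1 := hu.integrable r hr
  have h2 := hu.integrable (r + s) hrs
  have i1 := isFiniteMeasure_densityMeasure h1
  have i1' : IsFiniteMeasure (densityMeasure fun x => -u r x) :=
    isFiniteMeasure_densityMeasure h1.neg
  have i2 := isFiniteMeasure_densityMeasure h2
  have i2' : IsFiniteMeasure (densityMeasure fun x => -u (r + s) x) :=
    isFiniteMeasure_densityMeasure h2.neg
  -- The solution may change sign. Moving negative parts across the equation turns the claim into an
  -- equality of two finite positive measures.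
  set m₁ := P.kernel s ∘ₘ densityMeasure (u r) + densityMeasure (fun x => -u (r + s) x) with hm₁
  set m₂ := P.kernel s ∘ₘ densityMeasure (fun x => -u r x) + densityMeasure (u (r + s)) with hm₂
  have key : ∀ g : Space n → ℝ, Measurable g → ∀ N : ℝ, (∀ x, |g x| ≤ N) →
      (∫ x, g x ∂m₁) - ∫ x, g x ∂m₂ = (∫ x, P.act s g x * u r x) - ∫ x, g x * u (r + s) x := by
    intro g hg N hN
    have hi := fun (m : Measure (Space n)) (_ : IsFiniteMeasure m) =>
      MarkovSemigroup.integrable_of_bounded hg hN m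
    rw [hm₁, hm₂, integral_add_measure (hi _ inferInstance) (hi _ inferInstance),
      integral_add_measure (hi _ inferInstance) (hi _ inferInstance),
      integral_comp_kernel hg hN, integral_comp_kernel hg hN,
      ← integral_densityMeasure_sub_neg h1 (P.measurable_act hg s) (P.abs_act_le hN s),
      ← integral_densityMeasure_sub_neg h2 hg hN]
    simp only [MarkovSemigroup.act]
    ring
  have hm : m₁ = m₂ := by
    refine measure_ext_of_integral_contDiff ?_ fun g hg hgc => ?_
    · have := key (fun _ => 1) measurable_const 1 (by simp)
      have hr1 := hu.integral_eq hr
      have hrs1 := hu.integral_eq hrs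
      simp only [MarkovSemigroup.act, integral_const, probReal_univ, smul_eq_mul, mul_one,
        one_mul, hr1, hrs1, sub_self] at this
      exact (measureReal_eq_measureReal_iff).1 (sub_eq_zero.1 this)
    · obtain ⟨N, hN⟩ := hgc.exists_bound_of_continuous hg.continuous
      have := key g hg.continuous.measurable N hN
      rw [hu.integral_act_mul_of_contDiff hD ha hP hg hgc hr, sub_self] at this
      exact sub_eq_zero.1 this
  have := key f hf M hM
  rw [hm, sub_self] at this
  exact (sub_eq_zero.1 this.symm)

/-! ### Convexity on an interval and Bregman divergences. -/

section Convexity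

variable {I : Set ℝ} {Φ : ℝ → ℝ}

lemma tangent_le_of_convexOn {φ : ℝ → ℝ} {J : Set ℝ} (hφ : ConvexOn ℝ J φ) {x y d : ℝ}
    (hx : x ∈ J) (hy : y ∈ J) (hd : HasDerivWithinAt φ d J y) : φ y + d * (x - y) ≤ φ x := by
  rcases lt_trichotomy x y with h | rfl | h
  · have := hφ.slope_le_of_hasDerivWithinAt hx hy h hd
    rw [slope_def_field, div_le_iff₀ (sub_pos.2 h)] at this
    linarith
  · simp
  · have := hφ.le_slope_of_hasDerivWithinAt hy hx h hd
    rw [slope_def_field, le_div_iff₀ (sub_pos.2 h)] at this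
    linarith

/-- The Bregman divergence of `Φ` on the interval `I`. -/
noncomputable def bregman (I : Set ℝ) (Φ : ℝ → ℝ) (x y : ℝ) : ℝ :=
  Φ x - Φ y - derivWithin Φ I y * (x - y)

lemma bregman_nonneg (hΦ : ConvexOn ℝ I Φ) (hΦ_smooth : ContDiffOn ℝ 2 Φ I) {x y : ℝ}
    (hx : x ∈ I) (hy : y ∈ I) : 0 ≤ bregman I Φ x y := by
  have := tangent_le_of_convexOn hΦ hx hy
    (hΦ_smooth.differentiableOn (by simp) y hy).hasDerivWithinAt
  simp only [bregman]
  linarith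

lemma uniqueDiffOn_of_nontrivial (hI : Convex ℝ I) (h : I.Nontrivial) : UniqueDiffOn ℝ I :=
  uniqueDiffOn_convex hI (hI.nontrivial_iff_nonempty_interior.1 h)

/-- A one-point interval has no unique differentiability, hence the separate trivial case; the same
split recurs below. -/
lemma continuousOn_derivWithin_of_convex (hI : Convex ℝ I) (hΦ_smooth : ContDiffOn ℝ 2 Φ I) :
    ContinuousOn (derivWithin Φ I) I := by
  rcases I.subsingleton_or_nontrivial with h | h
  · exact h.continuousOn _
  · exact hΦ_smooth.continuousOn_derivWithin (uniqueDiffOn_of_nontrivial hI h) (by norm_num)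

lemma continuousOn_iteratedDerivWithin_of_convex (hI : Convex ℝ I)
    (hΦ_smooth : ContDiffOn ℝ 2 Φ I) : ContinuousOn (iteratedDerivWithin 2 Φ I) I := by
  rcases I.subsingleton_or_nontrivial with h | h
  · exact h.continuousOn _
  · exact hΦ_smooth.continuousOn_iteratedDerivWithin (by norm_num)
      (uniqueDiffOn_of_nontrivial hI h)

lemma iteratedDerivWithin_two_eq :
    iteratedDerivWithin 2 Φ I = derivWithin (derivWithin Φ I) I := by
  ext x
  rw [show (2 : ℕ) = 1 + 1 from rfl, iteratedDerivWithin_succ]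
  congr 1
  ext y
  simp [iteratedDerivWithin_one]

/-- Adding the divergences of `(y, z)` and `(z, y)` gives `(Φ'(z) - Φ'(y)) (z - y) ≥ 0`, so the
first derivative is monotone. -/
lemma iteratedDerivWithin_two_nonneg (hΦ : ConvexOn ℝ I Φ) (hΦ_smooth : ContDiffOn ℝ 2 Φ I)
    (x : ℝ) : 0 ≤ iteratedDerivWithin 2 Φ I x := by
  rw [iteratedDerivWithin_two_eq]
  refine MonotoneOn.derivWithin_nonneg ?_
  intro y hy z hz hyz
  have h1 := bregman_nonneg hΦ hΦ_smooth hy hz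
  have h2 := bregman_nonneg hΦ hΦ_smooth hz hy
  simp only [bregman] at h1 h2
  rcases eq_or_lt_of_le hyz with rfl | h
  · exact le_rfl
  · by_contra! hlt
    nlinarith

/-- The Bregman divergence is bounded below by its second order Taylor expansion. -/
lemma exists_sq_le_bregman (hΦ : ConvexOn ℝ I Φ) (hΦ_smooth : ContDiffOn ℝ 2 Φ I) {x κ : ℝ}
    (hx : x ∈ I) (hκ : κ < iteratedDerivWithin 2 Φ I x) :
    ∃ δ > 0, ∀ y ∈ I, |y - x| < δ → κ / 2 * (y - x) ^ 2 ≤ bregman I Φ x y := by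
  rcases I.subsingleton_or_nontrivial with h | h
  · refine ⟨1, one_pos, fun y hy _ => ?_⟩
    rw [h hy hx]
    simp [bregman]
  have hu := uniqueDiffOn_of_nontrivial hΦ.1 h
  have hd1 : ∀ y ∈ I, HasDerivWithinAt Φ (derivWithin Φ I y) I y := fun y hy =>
    (hΦ_smooth.differentiableOn (by simp) y hy).hasDerivWithinAt
  have hd2 : ∀ y ∈ I, HasDerivWithinAt (derivWithin Φ I) (iteratedDerivWithin 2 Φ I y) I y := by
    intro y hy
    rw [iteratedDerivWithin_two_eq]
    have : ContDiffOn ℝ 1 (derivWithin Φ I) I := hΦ_smooth.derivWithin hu (by norm_num)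
    exact (this.differentiableOn (by simp) y hy).hasDerivWithinAt
  have hcont := continuousOn_iteratedDerivWithin_of_convex hΦ.1 hΦ_smooth x hx
  obtain ⟨δ, hδ, hball⟩ := Metric.mem_nhdsWithin_iff.1 (hcont.eventually (lt_mem_nhds hκ))
  refine ⟨δ, hδ, fun y hy hyx => ?_⟩
  set J := Metric.ball x δ ∩ I
  have hJ : J ⊆ I := Set.inter_subset_right
  have hderiv : ∀ y ∈ J, HasDerivWithinAt (fun z => Φ z - κ / 2 * (z - x) ^ 2)
      (derivWithin Φ I y - κ * (y - x)) J y := by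
    intro y hy
    have h1 : HasDerivWithinAt (fun z => κ / 2 * (z - x) ^ 2) (κ * (y - x)) J y := by
      have := (((hasDerivWithinAt_id y J).sub_const x).pow 2).const_mul (κ / 2)
      refine this.congr_deriv ?_
      simp; ring
    exact ((hd1 y (hJ hy)).mono hJ).sub h1
  -- By continuity the second derivative exceeds `κ` on `J`, so subtracting the parabola keeps
  -- convexity. The tangent inequality at `y`, evaluated at `x`, is the claim.
  have hconv : ConvexOn ℝ J (fun z => Φ z - κ / 2 * (z - x) ^ 2) := by
    refine convexOn_of_hasDerivWithinAt2_nonneg ((convex_ball x δ).inter hΦ.1)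
      (f' := fun z => derivWithin Φ I z - κ * (z - x))
      (f'' := fun z => iteratedDerivWithin 2 Φ I z - κ)
      (fun z hz => (hderiv z hz).continuousWithinAt)
      (fun z hz => (hderiv z (interior_subset hz)).mono interior_subset) (fun z hz => ?_)
      (fun z hz => ?_)
    · have := ((hasDerivWithinAt_id z (interior J)).sub_const x).const_mul κ
      rw [mul_one] at this
      exact ((hd2 z (hJ (interior_subset hz))).mono (interior_subset.trans hJ)).sub this
    · have : κ < iteratedDerivWithin 2 Φ I z := hball (interior_subset hz)
      linarith
  have hyJ : y ∈ J := ⟨hyx, hy⟩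
  have := tangent_le_of_convexOn hconv ⟨Metric.mem_ball_self hδ, hx⟩ hyJ (hderiv y hyJ)
  simp only [bregman]
  simp only [sub_self] at this
  nlinarith

end Convexity

/-! ### The carré du champ, and regularity of the solution in time. -/

section DiffusionOperator

variable {D : Space n → Matrix (Fin n) (Fin n) ℝ} {a : Space n → Space n}

lemma gradient_apply (f : Space n → ℝ) (x : Space n) (i : Fin n) :
    gradient f x i = fderiv ℝ f x (EuclideanSpace.single i 1) := by
  have h := InnerProductSpace.toDual_symm_apply (𝕜 := ℝ) (x := EuclideanSpace.single i (1 : ℝ))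
    (y := fderiv ℝ f x)
  rw [EuclideanSpace.inner_single_right] at h
  simpa [gradient] using h

lemma divergence_smul {c : Space n → ℝ} {F : Space n → Space n} {x : Space n}
    (hc : DifferentiableAt ℝ c x) (hF : DifferentiableAt ℝ F x) :
    divergence (fun y => c y • F y) x = c x * divergence F x + inner ℝ (F x) (gradient c x) := by
  have hFi : ∀ i, DifferentiableAt ℝ (fun y => F y i) x := differentiableAt_euclidean.1 hF
  simp only [divergence, PiLp.inner_apply, gradient_apply, Finset.mul_sum,
    ← Finset.sum_add_distrib]
  refine Finset.sum_congr rfl fun i _ => ?_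
  simp only [PiLp.smul_apply, smul_eq_mul]
  rw [fderiv_fun_mul hc (hFi i)]
  simp [mul_comm]

/-- `Γ(f) = ⟨D ∇f, ∇f⟩`. -/
lemma carreDuChamp_eq (hD : ∀ i j, ContDiff ℝ ∞ (fun x => D x i j)) {f : Space n → ℝ}
    (hf : ContDiff ℝ 2 f) (x : Space n) :
    carreDuChamp D a f x = inner ℝ (mulField D (gradient f) x) (gradient f x) := by
  have hd : Differentiable ℝ f := hf.differentiable (by simp)
  have hg1 : ContDiff ℝ 1 (gradient f) := contDiff_gradient hf (by norm_num)
  have hm : ContDiff ℝ 1 (mulField D (gradient f)) :=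
    contDiff_mulField_apply hD (by exact_mod_cast le_top) hg1
  have h1 : gradient (fun y => f y ^ 2) = fun y => (2 * f y) • gradient f y := by
    ext y i
    rw [gradient_apply, PiLp.smul_apply, gradient_apply, fderiv_fun_pow _ (hd y)]
    simp
  have h2 : mulField D (gradient fun y => f y ^ 2)
      = fun y => (2 * f y) • mulField D (gradient f) y := by
    ext y i
    simp [mulField, h1]
  have h3 : gradient (fun y => 2 * f y) x = (2 : ℝ) • gradient f x := by
    ext i
    rw [gradient_apply, PiLp.smul_apply, gradient_apply, fderiv_const_mul (hd x)]
    simp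
  simp only [carreDuChamp, diffusionOp]
  rw [h2, divergence_smul ((hd x).const_mul 2) (hm.differentiable (by simp) x), h1, h3,
    inner_smul_right, inner_smul_right]
  ring

/-- For `f` a test function vanishing at `x`, this value is the limit of `P_s(f²)(x) / s`: the
quadratic variation seen from `x`. -/
lemma diffusionOp_sq_of_eq_zero (hD : ∀ i j, ContDiff ℝ ∞ (fun x => D x i j))
    {f : Space n → ℝ} (hf : ContDiff ℝ 2 f) {x : Space n} (hx : f x = 0) :
    diffusionOp D a (fun y => f y ^ 2) x
      = 2 * inner ℝ (mulField D (gradient f) x) (gradient f x) := by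
  rw [← carreDuChamp_eq (a := a) hD hf]
  simp only [carreDuChamp, hx]
  ring

lemma carreDuChamp_nonneg (hD : ∀ i j, ContDiff ℝ ∞ (fun x => D x i j))
    (hDpos : ∀ x, (D x).PosSemidef) {f : Space n → ℝ}
    (hf : ContDiff ℝ 2 f) (x : Space n) : 0 ≤ carreDuChamp D a f x := by
  rw [carreDuChamp_eq hD hf]
  have := (hDpos x).dotProduct_mulVec_nonneg (gradient f x).ofLp
  rw [EuclideanSpace.inner_eq_star_dotProduct]
  simpa [mulField, Matrix.toLpLin_apply] using this

lemma continuous_carreDuChamp (hD : ∀ i j, ContDiff ℝ ∞ (fun x => D x i j)) {f : Space n → ℝ}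
    (hf : ContDiff ℝ 2 f) : Continuous (carreDuChamp D a f) := by
  have hg1 : ContDiff ℝ 1 (gradient f) := contDiff_gradient hf (by norm_num)
  have hm : ContDiff ℝ 1 (mulField D (gradient f)) :=
    contDiff_mulField_apply hD (by exact_mod_cast le_top) hg1
  rw [funext (carreDuChamp_eq hD hf)]
  exact hm.continuous.inner hg1.continuous

/-- Expanding into `v`, `∇v`, `∇²v` and the coefficients makes joint continuity in `(t, x)` readable
from the assumptions on `u`. -/
lemma fokkerPlanckOp_eq (hD : ∀ i j, ContDiff ℝ ∞ (fun x => D x i j)) (ha : ContDiff ℝ ∞ a)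
    {v : Space n → ℝ} (hv : ContDiff ℝ 2 v) (x : Space n) :
    fokkerPlanckOp D a v x = ∑ i, ∑ j,
      (fderiv ℝ (fun y => D y i j) x (EuclideanSpace.single i 1)
          * (fderiv ℝ v x (EuclideanSpace.single j 1) + v x * a x j)
        + D x i j * (fderiv ℝ (fderiv ℝ v) x (EuclideanSpace.single i 1)
            (EuclideanSpace.single j 1)
          + (fderiv ℝ v x (EuclideanSpace.single i 1) * a x j
          + v x * fderiv ℝ (fun y => a y j) x (EuclideanSpace.single i 1)))) := by
  simp only [fokkerPlanckOp, divergence]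
  refine Finset.sum_congr rfl fun i _ => ?_
  have hvd : Differentiable ℝ v := hv.differentiable (by simp)
  have hv1 : Differentiable ℝ (fderiv ℝ v) :=
    (hv.fderiv_right (m := 1) (by norm_num)).differentiable (by simp)
  have had : ∀ j, Differentiable ℝ (fun y => a y j) := fun j =>
    (contDiff_euclidean.1 ha j).differentiable (by simp)
  have hDd : ∀ j, Differentiable ℝ (fun y => D y i j) := fun j =>
    (hD i j).differentiable (by simp)
  have hvj : ∀ j : Fin n, HasFDerivAt (fun y => fderiv ℝ v y (EuclideanSpace.single j 1))
      ((fderiv ℝ (fderiv ℝ v) x).flip (EuclideanSpace.single j 1)) x := fun j => by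
    simpa using (hv1 x).hasFDerivAt.clm_apply
      (hasFDerivAt_const (EuclideanSpace.single j (1 : ℝ)) x)
  have e : (fun y => mulField D (fun y => gradient v y + v y • a y) y i)
      = fun y => ∑ j, D y i j * (fderiv ℝ v y (EuclideanSpace.single j 1) + v y * a y j) := by
    ext y
    simp [mulField, Matrix.toLpLin_apply, Matrix.mulVec, dotProduct, gradient_apply]
  have hsum : HasFDerivAt
      (fun y => ∑ j, D y i j * (fderiv ℝ v y (EuclideanSpace.single j 1) + v y * a y j)) _ x :=
    HasFDerivAt.fun_sum fun j _ => (hDd j x).hasFDerivAt.mul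
      ((hvj j).add ((hvd x).hasFDerivAt.mul (had j x).hasFDerivAt))
  rw [e, hsum.fderiv]
  simp only [sum_apply, add_apply, smul_apply, smul_eq_mul, ContinuousLinearMap.flip_apply]
  refine Finset.sum_congr rfl fun j _ => ?_
  ring

lemma IsSolution.continuousOn_fokkerPlanckOp {P : MarkovSemigroup n} {u : ℝ → Space n → ℝ}
    (hu : IsSolution D a P u)
    (hD : ∀ i j, ContDiff ℝ ∞ (fun x => D x i j)) (ha : ContDiff ℝ ∞ a) :
    ContinuousOn (fun p : ℝ × Space n => fokkerPlanckOp D a (u p.1) p.2)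
      (Set.Ioi 0 ×ˢ Set.univ) := by
  have hD0 : ∀ i j, Continuous (fun p : ℝ × Space n => D p.2 i j) := fun i j =>
    (hD i j).continuous.comp continuous_snd
  have hD1 : ∀ i j, Continuous (fun p : ℝ × Space n =>
      fderiv ℝ (fun y => D y i j) p.2 (EuclideanSpace.single i 1)) := fun i j =>
    (((hD i j).continuous_fderiv (by simp)).clm_apply continuous_const).comp continuous_snd
  have ha0 : ∀ j, Continuous (fun p : ℝ × Space n => a p.2 j) := fun j =>
    (contDiff_euclidean.1 ha j).continuous.comp continuous_snd
  have ha1 : ∀ i j, Continuous (fun p : ℝ × Space n =>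
      fderiv ℝ (fun y => a y j) p.2 (EuclideanSpace.single i 1)) := fun i j =>
    (((contDiff_euclidean.1 ha j).continuous_fderiv (by simp)).clm_apply
      continuous_const).comp continuous_snd
  have hu0 := hu.continuousOn
  have hu1 : ∀ j : Fin n, ContinuousOn (fun p : ℝ × Space n =>
      fderiv ℝ (u p.1) p.2 (EuclideanSpace.single j 1)) (Set.Ioi 0 ×ˢ Set.univ) := fun j =>
    hu.continuousOn_fderiv.clm_apply continuousOn_const
  have hu2 : ∀ i j : Fin n, ContinuousOn (fun p : ℝ × Space n =>
      fderiv ℝ (fderiv ℝ (u p.1)) p.2 (EuclideanSpace.single i 1) (EuclideanSpace.single j 1))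
      (Set.Ioi 0 ×ˢ Set.univ) := fun i j =>
    (hu.continuousOn_fderiv_fderiv.clm_apply continuousOn_const).clm_apply continuousOn_const
  refine ContinuousOn.congr ?_ (fun p hp => fokkerPlanckOp_eq hD ha (hu.contDiff p.1 hp.1) p.2)
  refine continuousOn_finsetSum _ fun i _ => continuousOn_finsetSum _ fun j _ => ?_
  exact ((hD1 i j).continuousOn.mul ((hu1 j).add (hu0.mul (ha0 j).continuousOn))).add
    ((hD0 i j).continuousOn.mul ((hu2 i j).add (((hu1 i).mul (ha0 j).continuousOn).add
      (hu0.mul (ha1 i j).continuousOn))))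

/-- The solution is Lipschitz in time, locally uniformly in space. -/
lemma IsSolution.exists_abs_sub_le {P : MarkovSemigroup n} {u : ℝ → Space n → ℝ}
    (hu : IsSolution D a P u)
    (hD : ∀ i j, ContDiff ℝ ∞ (fun x => D x i j)) (ha : ContDiff ℝ ∞ a) {t : ℝ} (ht : 0 < t)
    (x : Space n) (r : ℝ) :
    ∃ M : ℝ, ∀ s, 0 ≤ s → s ≤ 1 → ∀ y ∈ Metric.closedBall x r, |u (t + s) y - u t y| ≤ M * s := by
  have hK : IsCompact (Set.Icc t (t + 1) ×ˢ Metric.closedBall x r) :=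
    isCompact_Icc.prod (isCompact_closedBall x r)
  obtain ⟨M, hM⟩ := hK.exists_bound_of_continuousOn
    ((hu.continuousOn_fokkerPlanckOp hD ha).mono
      (Set.prod_mono (fun s hs => ht.trans_le hs.1) (Set.subset_univ _)))
  refine ⟨M, fun s hs0 hs1 y hy => ?_⟩
  have := (convex_Icc t (t + 1)).norm_image_sub_le_of_norm_hasDerivWithin_le
    (f := fun s => u s y) (f' := fun s => fokkerPlanckOp D a (u s) y) (C := M)
    (fun s hs => (hu.equation s (ht.trans_le hs.1) y).hasDerivWithinAt)
    (fun s hs => hM (s, y) ⟨hs, hy⟩) (x := t) (y := t + s) ⟨le_rfl, by linarith⟩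
    ⟨by linarith, by linarith⟩
  simpa [abs_of_nonneg hs0] using this

end DiffusionOperator

/-! ### Conditional Jensen inequality with its Bregman defect. -/

section Jensen

variable {κ : Kernel (Space n) (Space n)} [IsMarkovKernel κ] {μ : Measure (Space n)}
  [IsProbabilityMeasure μ] {I : Set ℝ} {ψ d : ℝ → ℝ} {p q : Space n → ℝ}

lemma integral_kernel_of_invariant (hκ : κ.Invariant μ) {f : Space n → ℝ} (hf : Measurable f)
    {M : ℝ} (hM : ∀ x, |f x| ≤ M) : ∫ x, ∫ y, f y ∂(κ x) ∂μ = ∫ x, f x ∂μ := by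
  rw [← integral_comp_kernel hf hM, hκ.def]

lemma exists_bound_indicator {A : Set (Space n)} (hA : IsCompact A) {f : Space n → ℝ}
    (hf : Continuous f) : ∃ M : ℝ, ∀ x, |A.indicator f x| ≤ M := by
  obtain ⟨M, hM⟩ := hA.exists_bound_of_continuousOn hf.continuousOn
  refine ⟨max M 0, fun x => ?_⟩
  by_cases hx : x ∈ A
  · rw [Set.indicator_of_mem hx]
    exact (hM x hx).trans (le_max_left _ _)
  · simp [Set.indicator_of_notMem hx]

/-- Jensen's inequality for the adjoint of a Markov kernel, with the defect given by a Bregman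
divergence, on a compact set. -/
lemma lintegral_indicator_add_bregman_le (hκ : κ.Invariant μ)
    (hψ : ContinuousOn ψ I) (hd : ContinuousOn d I) (hψ0 : ∀ x ∈ I, 0 ≤ ψ x)
    (hB : ∀ x ∈ I, ∀ y ∈ I, 0 ≤ ψ x - ψ y - d y * (x - y))
    (hpI : ∀ x, p x ∈ I) (hp : Integrable p μ) (hψp : Integrable (fun x => ψ (p x)) μ)
    (hq : Continuous q) (hqI : ∀ x, q x ∈ I)
    (hdual : ∀ w : Space n → ℝ, Measurable w → ∀ M : ℝ, (∀ x, |w x| ≤ M) →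
      ∫ y, (∫ x, w x ∂(κ y)) * p y ∂μ = ∫ x, w x * q x ∂μ) {A : Set (Space n)}
    (hA : IsCompact A) :
    ∫⁻ x, A.indicator (fun x => ENNReal.ofReal (ψ (q x))) x ∂μ
      + ∫⁻ y, ∫⁻ x, A.indicator
        (fun x => ENNReal.ofReal (ψ (p y) - ψ (q x) - d (q x) * (p y - q x))) x ∂(κ y) ∂μ
      ≤ ∫⁻ x, ENNReal.ofReal (ψ (p x)) ∂μ := by
  have hψq : Continuous (fun x => ψ (q x)) := hψ.comp_continuous hq hqI
  have hdq : Continuous (fun x => d (q x)) := hd.comp_continuous hq hqI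
  have hAm : MeasurableSet A := hA.isClosed.measurableSet
  -- On `A`, `c x + w x * p y` is the tangent of `ψ` at `q x`, evaluated at `p y`; off `A` it is
  -- replaced by the minorant `0` of `ψ`. Compactness of `A` makes `w` and `c` bounded, so duality
  -- applies to `w` and invariance to `c`.
  set w : Space n → ℝ := A.indicator fun x => d (q x) with hw
  set c : Space n → ℝ := A.indicator fun x => ψ (q x) - d (q x) * q x with hc
  have hcc : Continuous fun x => ψ (q x) - d (q x) * q x := hψq.sub (hdq.mul hq)
  have hwm : Measurable w := hdq.measurable.indicator hAm
  have hcm : Measurable c := hcc.measurable.indicator hAm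
  obtain ⟨W, hW⟩ := exists_bound_indicator hA hdq
  obtain ⟨K, hK⟩ := exists_bound_indicator hA hcc
  obtain ⟨Q, hQ⟩ := exists_bound_indicator hA hψq
  have hint : ∀ {f : Space n → ℝ}, Measurable f → ∀ {M : ℝ}, (∀ x, |f x| ≤ M) →
      ∀ ν : Measure (Space n), IsFiniteMeasure ν → Integrable f ν := fun hf _ hM ν _ =>
    MarkovSemigroup.integrable_of_bounded hf hM ν
  have hpt : ∀ x y, 0 ≤ ψ (p y) - c x - w x * p y ∧
      A.indicator (fun x => ENNReal.ofReal (ψ (p y) - ψ (q x) - d (q x) * (p y - q x))) x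
        ≤ ENNReal.ofReal (ψ (p y) - c x - w x * p y) := by
    intro x y
    by_cases hx : x ∈ A
    · have e : ψ (p y) - c x - w x * p y = ψ (p y) - ψ (q x) - d (q x) * (p y - q x) := by
        simp only [hc, hw, Set.indicator_of_mem hx]
        ring
      rw [e, Set.indicator_of_mem hx]
      exact ⟨hB _ (hpI y) _ (hqI x), le_rfl⟩
    · simp only [hc, hw, Set.indicator_of_notMem hx]
      simpa using hψ0 _ (hpI y)
  have j1 : ∀ y, Integrable (fun x => ψ (p y) - c x) (κ y) := fun y =>
    (integrable_const _).sub (hint hcm hK _ inferInstance)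
  have j2 : ∀ y, Integrable (fun x => w x * p y) (κ y) := fun y =>
    (hint hwm hW _ inferInstance).mul_const _
  have j12 : ∀ y, Integrable (fun x => ψ (p y) - c x - w x * p y) (κ y) := fun y =>
    (j1 y).sub (j2 y)
  have hG : ∀ y, ∫ x, (ψ (p y) - c x - w x * p y) ∂(κ y)
      = ψ (p y) - (∫ x, c x ∂(κ y)) - (∫ x, w x ∂(κ y)) * p y := by
    intro y
    rw [integral_sub (j1 y) (j2 y),
      integral_sub (integrable_const _) (hint hcm hK _ inferInstance), integral_mul_const]
    simp
  have hinner : ∀ y, ∫⁻ x, A.indicator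
        (fun x => ENNReal.ofReal (ψ (p y) - ψ (q x) - d (q x) * (p y - q x))) x ∂(κ y)
      ≤ ENNReal.ofReal (ψ (p y) - (∫ x, c x ∂(κ y)) - (∫ x, w x ∂(κ y)) * p y) := by
    intro y
    rw [← hG, ofReal_integral_eq_lintegral_ofReal (j12 y)
      (Eventually.of_forall fun x => (hpt x y).1)]
    exact lintegral_mono fun x => (hpt x y).2
  have hGnn : ∀ y, 0 ≤ ψ (p y) - (∫ x, c x ∂(κ y)) - (∫ x, w x ∂(κ y)) * p y := fun y => by
    rw [← hG]
    exact integral_nonneg fun x => (hpt x y).1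
  have hPbound : ∀ {f : Space n → ℝ} {M : ℝ}, (∀ x, |f x| ≤ M) → ∀ y, |∫ x, f x ∂(κ y)| ≤ M :=
    fun {f M} hM y => by
      have := norm_integral_le_of_norm_le_const (μ := κ y) (f := f) (Eventually.of_forall hM)
      simpa using this
  have hPm : ∀ {f : Space n → ℝ}, Measurable f → Measurable fun y => ∫ x, f x ∂(κ y) :=
    fun hf => (StronglyMeasurable.integral_kernel hf.stronglyMeasurable).measurable
  have i1 : Integrable (fun y => ∫ x, c x ∂(κ y)) μ :=
    hint (hPm hcm) (hPbound hK) _ inferInstance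
  have i2 : Integrable (fun y => (∫ x, w x ∂(κ y)) * p y) μ :=
    hp.bdd_mul (hPm hwm).aestronglyMeasurable (Eventually.of_forall (hPbound hW))
  have i12 : Integrable (fun y => ψ (p y) - ∫ x, c x ∂(κ y)) μ := hψp.sub i1
  have i123 : Integrable (fun y => ψ (p y) - (∫ x, c x ∂(κ y)) - (∫ x, w x ∂(κ y)) * p y) μ :=
    i12.sub i2
  have iψq : Integrable (A.indicator fun x => ψ (q x)) μ :=
    hint (hψq.measurable.indicator hAm) hQ _ inferInstance
  -- Duality turns the `w` term into `∫ w q`, which cancels the part `-d(q) q` of `c` and leaves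
  -- only `ψ(q)` on `A`.
  have hGint : ∫ y, (ψ (p y) - (∫ x, c x ∂(κ y)) - (∫ x, w x ∂(κ y)) * p y) ∂μ
      = (∫ y, ψ (p y) ∂μ) - ∫ x, A.indicator (fun x => ψ (q x)) x ∂μ := by
    obtain ⟨R, hR⟩ := exists_bound_indicator hA (hdq.mul hq)
    have ewq : (fun x => w x * q x) = A.indicator fun x => d (q x) * q x := by
      ext x
      by_cases hx : x ∈ A <;> simp [hw, hx]
    have iwq : Integrable (fun x => w x * q x) μ := by
      rw [ewq]
      exact hint ((hdq.mul hq).measurable.indicator hAm) hR _ inferInstance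
    rw [integral_sub i12 i2, integral_sub hψp i1, hdual w hwm W hW,
      integral_kernel_of_invariant hκ hcm hK, sub_sub,
      ← integral_add (hint hcm hK _ inferInstance) iwq]
    congr 2
    ext x
    by_cases hx : x ∈ A <;> simp [hw, hc, hx]
  have hind : ∀ x, A.indicator (fun x => ENNReal.ofReal (ψ (q x))) x
      = ENNReal.ofReal (A.indicator (fun x => ψ (q x)) x) := fun x => by
    by_cases hx : x ∈ A <;> simp [hx]
  have hind0 : ∀ x, 0 ≤ A.indicator (fun x => ψ (q x)) x :=
    fun x => Set.indicator_nonneg (fun x _ => hψ0 _ (hqI x)) x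
  calc
    _ ≤ ENNReal.ofReal (∫ x, A.indicator (fun x => ψ (q x)) x ∂μ)
        + ENNReal.ofReal ((∫ y, ψ (p y) ∂μ) - ∫ x, A.indicator (fun x => ψ (q x)) x ∂μ) := by
      refine add_le_add ?_ ?_
      · simp_rw [hind]
        rw [ofReal_integral_eq_lintegral_ofReal iψq (Eventually.of_forall hind0)]
      · rw [← hGint, ofReal_integral_eq_lintegral_ofReal i123 (Eventually.of_forall hGnn)]
        exact lintegral_mono hinner
    _ = ENNReal.ofReal (∫ y, ψ (p y) ∂μ) := by
      rw [← ENNReal.ofReal_add (integral_nonneg hind0), add_sub_cancel]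
      rw [← hGint]
      exact integral_nonneg hGnn
    _ = _ := ofReal_integral_eq_lintegral_ofReal hψp (Eventually.of_forall fun x => hψ0 _ (hpI x))

lemma monotone_indicator_closedBall (f : Space n → ℝ≥0∞) (x : Space n) :
    Monotone fun N : ℕ => (Metric.closedBall (0 : Space n) N).indicator f x := by
  intro N N' h
  exact Set.indicator_le_indicator_of_subset
    (Metric.closedBall_subset_closedBall (by exact_mod_cast h)) (fun _ => zero_le) x

lemma tendsto_indicator_closedBall (f : Space n → ℝ≥0∞) (x : Space n) :
    Tendsto (fun N : ℕ => (Metric.closedBall (0 : Space n) N).indicator f x) atTop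
      (𝓝 (f x)) := by
  obtain ⟨K, hK⟩ := exists_nat_ge ‖x‖
  refine tendsto_const_nhds.congr' ?_
  filter_upwards [eventually_ge_atTop K] with N hN
  have : (K : ℝ) ≤ N := by exact_mod_cast hN
  rw [Set.indicator_of_mem]
  rw [mem_closedBall_zero_iff]
  exact hK.trans this

lemma tendsto_lintegral_indicator_closedBall {f : Space n → ℝ≥0∞} (hf : Measurable f)
    (ν : Measure (Space n)) :
    Tendsto (fun N : ℕ => ∫⁻ x, (Metric.closedBall (0 : Space n) N).indicator f x ∂ν) atTop
      (𝓝 (∫⁻ x, f x ∂ν)) :=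
  lintegral_tendsto_of_tendsto_of_monotone
    (fun _ => (hf.indicator Metric.isClosed_closedBall.measurableSet).aemeasurable)
    (Eventually.of_forall (monotone_indicator_closedBall f))
    (Eventually.of_forall (tendsto_indicator_closedBall f))

/-- Jensen's inequality for the adjoint of a Markov kernel. -/
lemma lintegral_le_of_invariant (hκ : κ.Invariant μ)
    (hψ : ContinuousOn ψ I) (hd : ContinuousOn d I) (hψ0 : ∀ x ∈ I, 0 ≤ ψ x)
    (hB : ∀ x ∈ I, ∀ y ∈ I, 0 ≤ ψ x - ψ y - d y * (x - y))
    (hpI : ∀ x, p x ∈ I) (hp : Integrable p μ) (hψp : Integrable (fun x => ψ (p x)) μ)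
    (hq : Continuous q) (hqI : ∀ x, q x ∈ I)
    (hdual : ∀ w : Space n → ℝ, Measurable w → ∀ M : ℝ, (∀ x, |w x| ≤ M) →
      ∫ y, (∫ x, w x ∂(κ y)) * p y ∂μ = ∫ x, w x * q x ∂μ) :
    ∫⁻ x, ENNReal.ofReal (ψ (q x)) ∂μ ≤ ∫⁻ x, ENNReal.ofReal (ψ (p x)) ∂μ := by
  have hψq : Continuous (fun x => ψ (q x)) := hψ.comp_continuous hq hqI
  refine le_of_tendsto' (tendsto_lintegral_indicator_closedBall
    hψq.measurable.ennreal_ofReal μ) fun N => ?_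
  exact le_self_add.trans (lintegral_indicator_add_bregman_le hκ hψ hd hψ0 hB hpI hp hψp hq hqI
    hdual (isCompact_closedBall 0 (N : ℝ)))

/-- Jensen's inequality for the adjoint of a Markov kernel, with the defect given by a Bregman
divergence. -/
lemma lintegral_add_bregman_le (hκ : κ.Invariant μ)
    (hψ : ContinuousOn ψ I) (hd : ContinuousOn d I) (hψ0 : ∀ x ∈ I, 0 ≤ ψ x)
    (hB : ∀ x ∈ I, ∀ y ∈ I, 0 ≤ ψ x - ψ y - d y * (x - y))
    (hpI : ∀ x, p x ∈ I) (hp : Integrable p μ) (hψp : Integrable (fun x => ψ (p x)) μ)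
    (hpc : Continuous p) (hq : Continuous q) (hqI : ∀ x, q x ∈ I)
    (hdual : ∀ w : Space n → ℝ, Measurable w → ∀ M : ℝ, (∀ x, |w x| ≤ M) →
      ∫ y, (∫ x, w x ∂(κ y)) * p y ∂μ = ∫ x, w x * q x ∂μ) :
    ∫⁻ x, ENNReal.ofReal (ψ (q x)) ∂μ
      + ∫⁻ y, ∫⁻ x, ENNReal.ofReal (ψ (p y) - ψ (q x) - d (q x) * (p y - q x)) ∂(κ y) ∂μ
      ≤ ∫⁻ x, ENNReal.ofReal (ψ (p x)) ∂μ := by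
  have hψq : Continuous (fun x => ψ (q x)) := hψ.comp_continuous hq hqI
  have hψpc : Continuous (fun x => ψ (p x)) := hψ.comp_continuous hpc hpI
  have hdq : Continuous (fun x => d (q x)) := hd.comp_continuous hq hqI
  -- Continuity of `p` enters here, to make the inner kernel integrals measurable for monotone
  -- convergence.
  have hjoint : Continuous (fun z : Space n × Space n =>
      ENNReal.ofReal (ψ (p z.1) - ψ (q z.2) - d (q z.2) * (p z.1 - q z.2))) := by
    refine ENNReal.continuous_ofReal.comp ?_
    exact ((hψpc.comp continuous_fst).sub (hψq.comp continuous_snd)).sub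
      ((hdq.comp continuous_snd).mul ((hpc.comp continuous_fst).sub (hq.comp continuous_snd)))
  refine le_of_tendsto' ((tendsto_lintegral_indicator_closedBall
    hψq.measurable.ennreal_ofReal μ).add (lintegral_tendsto_of_tendsto_of_monotone
      (f := fun (N : ℕ) y => ∫⁻ x, (Metric.closedBall (0 : Space n) N).indicator
        (fun x => ENNReal.ofReal (ψ (p y) - ψ (q x) - d (q x) * (p y - q x))) x ∂(κ y))
      (fun N => ?_) ?_ ?_)) fun N =>
    lintegral_indicator_add_bregman_le hκ hψ hd hψ0 hB hpI hp hψp hq hqI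
      hdual (isCompact_closedBall 0 (N : ℝ))
  · refine (Measurable.lintegral_kernel_prod_right ?_).aemeasurable
    exact hjoint.measurable.indicator
      (s := Prod.snd ⁻¹' Metric.closedBall (0 : Space n) N)
      (measurable_snd Metric.isClosed_closedBall.measurableSet)
  · exact Eventually.of_forall fun y N N' h =>
      lintegral_mono fun x => monotone_indicator_closedBall _ x h
  · exact Eventually.of_forall fun y => tendsto_lintegral_indicator_closedBall
      (hjoint.comp (Continuous.prodMk_right y)).measurable _

end Jensen

/-! ### Small-time lower bound for the Bregman divergence. -/

lemma ofReal_integral_le_lintegral_ofReal {ν : Measure (Space n)} {h : Space n → ℝ}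
    (hh : Integrable h ν) : ENNReal.ofReal (∫ x, h x ∂ν) ≤ ∫⁻ x, ENNReal.ofReal (h x) ∂ν := by
  calc ENNReal.ofReal (∫ x, h x ∂ν) ≤ ENNReal.ofReal (∫ x, max (h x) 0 ∂ν) :=
        ENNReal.ofReal_le_ofReal (integral_mono hh hh.pos_part fun x => le_max_left _ _)
    _ = ∫⁻ x, ENNReal.ofReal (max (h x) 0) ∂ν :=
        ofReal_integral_eq_lintegral_ofReal hh.pos_part
          (Eventually.of_forall fun x => le_max_right _ _)
    _ = ∫⁻ x, ENNReal.ofReal (h x) ∂ν := by simp [ENNReal.ofReal_max]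

/-- Young's inequality `(l + σ)² ≥ (1 - η) l² - σ²/η` with `σ = ρ + τ`, then `σ² ≤ 2ρ² + 2τ²`.
Below, `l` is the linear part of `p`, `ρ` its Taylor remainder and `τ` the displacement in time. -/
lemma le_sq_of_abs_le {η l ρ τ d m : ℝ} (hη : 0 < η) (hρ : |ρ| ≤ η * d) (hτ : |τ| ≤ m) :
    (1 - η) * l ^ 2 - 2 * η * d ^ 2 - 2 / η * m ^ 2 ≤ (l + ρ + τ) ^ 2 := by
  have h1 : τ ^ 2 ≤ m ^ 2 := sq_le_sq' (abs_le.1 hτ).1 (abs_le.1 hτ).2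
  have h2 : ρ ^ 2 ≤ (η * d) ^ 2 := sq_le_sq' (abs_le.1 hρ).1 (abs_le.1 hρ).2
  have h3 : (ρ + τ) ^ 2 / η ≤ 2 * η * d ^ 2 + 2 / η * m ^ 2 := by
    have e : 2 * η * d ^ 2 + 2 / η * m ^ 2 = (2 * (η * d) ^ 2 + 2 * m ^ 2) / η := by
      field_simp
    rw [e]
    refine div_le_div_of_nonneg_right ?_ hη.le
    linarith [sq_nonneg (ρ - τ), add_sq ρ τ, sub_sq ρ τ]
  have h4 : 0 ≤ (η * l + (ρ + τ)) ^ 2 / η + (ρ + τ) ^ 2 := by positivity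
  have h5 : (η * l + (ρ + τ)) ^ 2 / η + (ρ + τ) ^ 2
      = (l + ρ + τ) ^ 2 - (1 - η) * l ^ 2 + (ρ + τ) ^ 2 / η := by
    field_simp
    ring
  linarith

/-- The quadratic variation of the semigroup at small times controls the carré du champ: the
rescaled mean Bregman divergence is asymptotically at least `Φ''(p) Γ(p)`. -/
lemma eventually_le_lintegral_bregman {D : Space n → Matrix (Fin n) (Fin n) ℝ}
    {a : Space n → Space n} (hD : ∀ i j, ContDiff ℝ ∞ (fun x => D x i j))
    {P : MarkovSemigroup n} (hP : P.HasDiffusionGenerator D a) {I : Set ℝ} {Φ : ℝ → ℝ}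
    (hΦ : ConvexOn ℝ I Φ) (hΦ_smooth : ContDiffOn ℝ 2 Φ I) {p : Space n → ℝ}
    (hp : ContDiff ℝ 2 p) (hpI : ∀ x, p x ∈ I) {q : ℝ≥0 → Space n → ℝ} (hqI : ∀ s x, q s x ∈ I)
    {y : Space n} {M : ℝ} (hM : ∀ s : ℝ≥0, s ≤ 1 → ∀ x ∈ Metric.closedBall y 1,
      |q s x - p x| ≤ M * s) {c : ℝ} (hc0 : 0 ≤ c)
    (hc : c < iteratedDerivWithin 2 Φ I (p y) * carreDuChamp D a p y) :
    ∀ᶠ s : ℝ≥0 in 𝓝[>] 0, ENNReal.ofReal c ≤ ENNReal.ofReal (1 / s) *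
      ∫⁻ x, ENNReal.ofReal (bregman I Φ (p y) (q s x)) ∂(P.kernel s y) := by
  set G := carreDuChamp D a p y with hG
  have hφ2 := iteratedDerivWithin_two_nonneg hΦ hΦ_smooth (p y)
  set φ2 := iteratedDerivWithin 2 Φ I (p y) with hφ2_def
  have hGpos : 0 < G := pos_of_mul_pos_right (hc0.trans_lt hc) hφ2
  obtain ⟨κ, hκ1, hκ2⟩ : ∃ κ, c / G < κ ∧ κ < φ2 := exists_between ((div_lt_iff₀ hGpos).2 hc)
  have hκ0 : 0 < κ := (div_nonneg hc0 hGpos.le).trans_lt hκ1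
  have hκc : c < κ * G := (div_lt_iff₀ hGpos).1 hκ1
  obtain ⟨δ, hδ, hδB⟩ := exists_sq_le_bregman hΦ hΦ_smooth (hpI y) hκ2
  -- The radii are fixed once and for all, so `K` does not depend on `η`; `η` can be chosen after
  -- `K`, and the Taylor radius `r` after `η`.
  let χ₀ : ContDiffBump y := ⟨1, 2, one_pos, one_lt_two⟩
  set k : Space n → ℝ := fun x => χ₀ x ^ 2 * ‖x - y‖ ^ 2 with hk
  have hk_smooth : ContDiff ℝ ∞ k :=
    (χ₀.contDiff.pow 2).mul ((contDiff_id.sub contDiff_const).norm_sq ℝ)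
  have hk_supp : HasCompactSupport k := by
    refine HasCompactSupport.mul_right ?_
    simp_rw [pow_two]
    exact χ₀.hasCompactSupport.mul_right
  set K := diffusionOp D a k y with hK
  -- choice of the linearization parameter
  obtain ⟨η, hη0, hη1, hηc⟩ : ∃ η : ℝ, 0 < η ∧ η < 1 ∧
      c < κ / 2 * ((1 - η) * (2 * G) - 2 * η * K) := by
    have hcont : Continuous fun η : ℝ => κ / 2 * ((1 - η) * (2 * G) - 2 * η * K) := by fun_prop
    -- At `η = 0` the value is `κ * G`, which exceeds `c` by the choice of `κ`.
    have h0 : c < (fun η : ℝ => κ / 2 * ((1 - η) * (2 * G) - 2 * η * K)) 0 := by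
      simp only
      linarith
    have h1 : ∀ᶠ η : ℝ in 𝓝[>] 0, c < κ / 2 * ((1 - η) * (2 * G) - 2 * η * K) :=
      (hcont.continuousAt.eventually (lt_mem_nhds h0)).filter_mono nhdsWithin_le_nhds
    have h2 : ∀ᶠ η : ℝ in 𝓝[>] 0, η < 1 :=
      Eventually.filter_mono nhdsWithin_le_nhds (gt_mem_nhds one_pos)
    obtain ⟨η, ha, hb, hη⟩ := (h1.and (h2.and self_mem_nhdsWithin)).exists
    exact ⟨η, hη, hb, ha⟩
  have hpd : HasFDerivAt p (fderiv ℝ p y) y := (hp.differentiable (by simp) y).hasFDerivAt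
  obtain ⟨r, hr0, hr1, hrlin, hrδ⟩ : ∃ r : ℝ, 0 < r ∧ r < 1 ∧
      (∀ x ∈ Metric.ball y r, |p x - p y - fderiv ℝ p y (x - y)| ≤ η * ‖x - y‖) ∧
      ∀ x ∈ Metric.ball y r, |p x - p y| < δ / 2 := by
    have e1 := hpd.isLittleO.def hη0
    have e2 : ∀ᶠ x in 𝓝 y, |p x - p y| < δ / 2 := by
      have := Metric.tendsto_nhds.1 (hp.continuous.tendsto y) (δ / 2) (by positivity)
      simpa [Real.dist_eq] using this
    obtain ⟨r, hr0, hr⟩ := Metric.eventually_nhds_iff_ball.1 (e1.and e2)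
    refine ⟨min r (1 / 2), by positivity, (min_le_right _ _).trans_lt (by norm_num),
      fun x hx => ?_, fun x hx => ?_⟩
    · simpa using (hr x (Metric.ball_subset_ball (min_le_left _ _) hx)).1
    · exact (hr x (Metric.ball_subset_ball (min_le_left _ _) hx)).2
  let χ : ContDiffBump y := ⟨r / 2, r, by positivity, by linarith⟩
  -- A compactly supported copy of the differential of `p` at `y`: `p` is only `C²`, so the
  -- generator cannot be applied to it directly.
  set g : Space n → ℝ := fun x => χ x * fderiv ℝ p y (x - y) with hg
  have hlin_smooth : ContDiff ℝ ∞ fun x => fderiv ℝ p y (x - y) :=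
    (fderiv ℝ p y).contDiff.comp (contDiff_id.sub contDiff_const)
  have hg_smooth : ContDiff ℝ ∞ g := χ.contDiff.mul hlin_smooth
  have hg_supp : HasCompactSupport g := χ.hasCompactSupport.mul_right
  have hgy : g y = 0 := by simp [hg]
  have hky : k y = 0 := by simp [hk]
  have hgradient : gradient g y = gradient p y := by
    have : g =ᶠ[𝓝 y] fun x => fderiv ℝ p y (x - y) := by
      filter_upwards [χ.eventuallyEq_one] with x hx
      simp [hg, hx]
    have hd : HasFDerivAt (fun x => fderiv ℝ p y (x - y)) (fderiv ℝ p y) y := by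
      exact (fderiv ℝ p y).hasFDerivAt.comp y ((hasFDerivAt_id y).sub_const y)
    simp only [gradient, this.fderiv_eq, hd.fderiv]
  have hLg : diffusionOp D a (fun x => g x ^ 2) y = 2 * G := by
    rw [diffusionOp_sq_of_eq_zero hD (hg_smooth.of_le (by norm_cast)) hgy, hG,
      carreDuChamp_eq hD hp]
    simp only [mulField, hgradient]
  have hg2_smooth : ContDiff ℝ ∞ fun x => g x ^ 2 := hg_smooth.pow 2
  have hg2_supp : HasCompactSupport fun x => g x ^ 2 := by
    simp_rw [pow_two]
    exact hg_supp.mul_right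
  have hgen_g := (hP _ hg2_smooth hg2_supp).tendsto y
  have hgen_k := (hP _ hk_smooth hk_supp).tendsto y
  rw [hLg] at hgen_g
  simp only [hgy, hky, sub_zero, ne_eq, OfNat.ofNat_ne_zero, not_false_eq_true, zero_pow]
    at hgen_g hgen_k
  have hs0 : Tendsto (fun s : ℝ≥0 => (s : ℝ)) (𝓝[>] 0) (𝓝 0) := by
    have : Tendsto (fun s : ℝ≥0 => (s : ℝ)) (𝓝 0) (𝓝 ((0 : ℝ≥0) : ℝ)) :=
      NNReal.continuous_coe.tendsto 0
    exact this.mono_left nhdsWithin_le_nhds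
  -- The displacement `q s - p` is `O(s)`; its square divided by `s` disappears in the limit.
  have hlim : Tendsto (fun s : ℝ≥0 => κ / 2 * ((1 - η) * (P.act s (fun x => g x ^ 2) y / s)
      - 2 * η * (P.act s k y / s) - 2 / η * M ^ 2 * s)) (𝓝[>] 0)
      (𝓝 (κ / 2 * ((1 - η) * (2 * G) - 2 * η * K))) := by
    have := (((hgen_g.const_mul (1 - η)).sub (hgen_k.const_mul (2 * η))).sub
      (hs0.const_mul (2 / η * M ^ 2))).const_mul (κ / 2)
    simpa using this
  have hMs : ∀ᶠ s : ℝ≥0 in 𝓝[>] 0, M * s < δ / 2 := by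
    have := hs0.const_mul M
    rw [mul_zero] at this
    exact this.eventually (gt_mem_nhds (by positivity))
  have hs1 : ∀ᶠ s : ℝ≥0 in 𝓝[>] 0, (s : ℝ) < 1 := hs0.eventually (gt_mem_nhds one_pos)
  filter_upwards [hlim.eventually (lt_mem_nhds hηc), hMs, hs1, self_mem_nhdsWithin]
    with s hsc hsM hs1 hspos
  have hspos' : (0 : ℝ) < s := hspos
  have hs1' : s ≤ 1 := by exact_mod_cast hs1.le
  -- Inside the ball this is the quadratic lower bound combined with Young's inequality; outside,
  -- `g` vanishes, the left side is nonpositive and the divergence is nonnegative.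
  have hpt : ∀ x, κ / 2 * ((1 - η) * g x ^ 2 - 2 * η * k x - 2 / η * M ^ 2 * (s : ℝ) ^ 2)
      ≤ bregman I Φ (p y) (q s x) := by
    intro x
    have hB0 := bregman_nonneg hΦ hΦ_smooth (hpI y) (hqI s x)
    have hk0 : 0 ≤ k x := by positivity
    have hMs0 : 0 ≤ 2 / η * M ^ 2 * (s : ℝ) ^ 2 := by positivity
    by_cases hx : x ∈ Metric.ball y r
    · have hx1 : x ∈ Metric.closedBall y 1 :=
        Metric.ball_subset_closedBall (Metric.ball_subset_ball hr1.le hx)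
      have hχ₀ : χ₀ x = 1 := χ₀.one_of_mem_closedBall hx1
      have hkx : k x = ‖x - y‖ ^ 2 := by simp [hk, hχ₀]
      have hχ0 : 0 ≤ χ x := χ.nonneg
      have hχ1 : χ x ≤ 1 := χ.le_one
      have hτ := hM s hs1' x hx1
      have hρ := hrlin x hx
      have hclose : |q s x - p y| < δ := by
        have h1 := abs_add_le (q s x - p x) (p x - p y)
        rw [sub_add_sub_cancel] at h1
        linarith [hrδ x hx]
      have hBq := hδB _ (hqI s x) hclose
      have hmain := le_sq_of_abs_le (l := fderiv ℝ p y (x - y)) hη0 hρ hτ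
      rw [show fderiv ℝ p y (x - y) + (p x - p y - fderiv ℝ p y (x - y)) + (q s x - p x)
        = q s x - p y by ring, mul_pow, ← mul_assoc] at hmain
      have hgx : g x ^ 2 ≤ (fderiv ℝ p y (x - y)) ^ 2 := by
        rw [hg, mul_pow]
        exact mul_le_of_le_one_left (sq_nonneg _) (pow_le_one₀ hχ0 hχ1)
      refine le_trans ?_ hBq
      refine mul_le_mul_of_nonneg_left ?_ (by positivity)
      rw [hkx]
      have := mul_le_mul_of_nonneg_left hgx (sub_nonneg.2 hη1.le)
      linarith
    · have hgx : g x = 0 := by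
        have : χ x = 0 := χ.zero_of_le_dist (not_lt.1 hx)
        simp [hg, this]
      refine le_trans ?_ hB0
      rw [hgx]
      refine mul_nonpos_of_nonneg_of_nonpos (by positivity) ?_
      have : 0 ≤ 2 * η * k x := by positivity
      linarith
  have ig : Integrable (fun x => (1 - η) * g x ^ 2) (P.kernel s y) :=
    (hg2_smooth.continuous.integrable_of_hasCompactSupport hg2_supp).const_mul _
  have ik : Integrable (fun x => 2 * η * k x) (P.kernel s y) :=
    (hk_smooth.continuous.integrable_of_hasCompactSupport hk_supp).const_mul _
  have igk : Integrable (fun x => (1 - η) * g x ^ 2 - 2 * η * k x) (P.kernel s y) := ig.sub ik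
  have ih : Integrable (fun x => κ / 2 * ((1 - η) * g x ^ 2 - 2 * η * k x
      - 2 / η * M ^ 2 * (s : ℝ) ^ 2)) (P.kernel s y) :=
    (igk.sub (integrable_const _)).const_mul _
  have hint : ∫ x, κ / 2 * ((1 - η) * g x ^ 2 - 2 * η * k x
      - 2 / η * M ^ 2 * (s : ℝ) ^ 2) ∂(P.kernel s y)
      = κ / 2 * ((1 - η) * P.act s (fun x => g x ^ 2) y - 2 * η * P.act s k y
        - 2 / η * M ^ 2 * (s : ℝ) ^ 2) := by
    rw [integral_const_mul, integral_sub igk (integrable_const _), integral_sub ig ik,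
      integral_const_mul, integral_const_mul]
    simp [MarkovSemigroup.act]
  calc ENNReal.ofReal c ≤ ENNReal.ofReal (1 / s * (κ / 2 * ((1 - η) * P.act s (fun x => g x ^ 2) y
        - 2 * η * P.act s k y - 2 / η * M ^ 2 * (s : ℝ) ^ 2))) := by
        refine ENNReal.ofReal_le_ofReal (hsc.le.trans (le_of_eq ?_))
        field_simp
    _ = ENNReal.ofReal (1 / s) * ENNReal.ofReal (∫ x, κ / 2 * ((1 - η) * g x ^ 2 - 2 * η * k x
          - 2 / η * M ^ 2 * (s : ℝ) ^ 2) ∂(P.kernel s y)) := by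
        rw [hint, ENNReal.ofReal_mul (by positivity)]
    _ ≤ _ := by
        refine mul_le_mul_right ?_ _
        exact (ofReal_integral_le_lintegral_ofReal ih).trans
          (lintegral_mono fun x => ENNReal.ofReal_le_ofReal (hpt x))

/-- A nonincreasing function which decays at the exponential rate `r` along small time steps
decays at the rate `r`. -/
lemma le_mul_exp_of_frequently_step {e : ℝ → ℝ} {r s T : ℝ} (hsT : s ≤ T)
    (hmono : ∀ x y, s ≤ x → x ≤ y → e y ≤ e x)
    (hstep : ∀ x, s ≤ x → ∀ δ > 0, ∃ h, 0 < h ∧ h < δ ∧ e (x + h) ≤ e x * Real.exp (-r * h)) :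
    e T ≤ e s * Real.exp (-r * (T - s)) := by
  set S := {x ∈ Set.Icc s T | e x ≤ e s * Real.exp (-r * (x - s))} with hS
  have hsS : s ∈ S := ⟨⟨le_rfl, hsT⟩, by simp⟩
  have hbdd : BddAbove S := ⟨T, fun x hx => hx.1.2⟩
  obtain ⟨v, -, hv, hvS⟩ := exists_seq_tendsto_sSup ⟨s, hsS⟩ hbdd
  set t := sSup S with ht
  have hst : s ≤ t := le_csSup hbdd hsS
  have htT : t ≤ T := csSup_le ⟨s, hsS⟩ fun x hx => hx.1.2
  have het : e t ≤ e s * Real.exp (-r * (t - s)) := by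
    have hcont : Continuous fun x => e s * Real.exp (-r * (x - s)) := by fun_prop
    -- The supremum belongs to `S` without any continuity of `e`: points of `S` lie to the left of
    -- `t`, where `e` is larger.
    refine ge_of_tendsto' ((hcont.tendsto t).comp hv) fun k => ?_
    exact (hmono _ _ (hvS k).1.1 (le_csSup hbdd (hvS k))).trans (hvS k).2
  rcases eq_or_lt_of_le htT with h | h
  · rwa [h] at het
  · obtain ⟨δ, hδ0, hδ, hδe⟩ := hstep t hst (T - t) (sub_pos.2 h)
    have hmem : t + δ ∈ S := by
      refine ⟨⟨by linarith, by linarith⟩, hδe.trans ?_⟩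
      calc e t * Real.exp (-r * δ) ≤ e s * Real.exp (-r * (t - s)) * Real.exp (-r * δ) := by
            gcongr
        _ = e s * Real.exp (-r * (t + δ - s)) := by
            rw [mul_assoc, ← Real.exp_add]
            ring_nf
    linarith [le_csSup hbdd hmem]

/-! ### Entropy dissipation along the solution. -/

section Entropy

variable {D : Space n → Matrix (Fin n) (Fin n) ℝ} {a : Space n → Space n}
  {P : MarkovSemigroup n} {uInf : Space n → ℝ} {I : Set ℝ} {Φ : ℝ → ℝ}
  {u : ℝ → Space n → ℝ}

lemma integral_densityMeasure_of_pos (hc : Continuous uInf) (hpos : ∀ x, 0 < uInf x)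
    (f : Space n → ℝ) : ∫ x, f x ∂(densityMeasure uInf) = ∫ x, f x * uInf x := by
  rw [integral_densityMeasure hc.measurable.aemeasurable]
  simp only [max_eq_left (hpos _).le]

lemma integrable_densityMeasure_div (hc : Continuous uInf) (hpos : ∀ x, 0 < uInf x)
    {v : Space n → ℝ} (hv : Integrable v) :
    Integrable (fun x => v x / uInf x) (densityMeasure uInf) := by
  rw [densityMeasure, integrable_withDensity_iff hc.measurable.ennreal_ofReal
    (Eventually.of_forall fun _ => ENNReal.ofReal_lt_top)]
  refine hv.congr (Eventually.of_forall fun x => ?_)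
  simp only [ENNReal.toReal_ofReal (hpos x).le]
  rw [div_mul_cancel₀ _ (hpos x).ne']

lemma integral_mem_of_convex {μ : Measure (Space n)} [IsProbabilityMeasure μ]
    (hI : Convex ℝ I) {f : Space n → ℝ} (hfI : ∀ x, f x ∈ I) (hf : Integrable f μ) :
    ∫ x, f x ∂μ ∈ I := by
  obtain ⟨x, hx⟩ := exists_le_integral hf
  obtain ⟨y, hy⟩ := exists_integral_le hf
  exact hI.ordConnected.out (hfI x) (hfI y) ⟨hx, hy⟩

lemma IsSolution.contDiff_div (hu : IsSolution D a P u) (hsmooth : ContDiff ℝ 2 uInf)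
    (hpos : ∀ x, 0 < uInf x) {t : ℝ} (ht : 0 < t) : ContDiff ℝ 2 fun x => u t x / uInf x :=
  (hu.contDiff t ht).div hsmooth fun x => (hpos x).ne'

/-- Duality between the semigroup and the relative density of the solution. -/
lemma IsSolution.integral_act_mul_div (hu : IsSolution D a P u)
    (hD : ∀ i j, ContDiff ℝ ∞ (fun x => D x i j)) (ha : ContDiff ℝ ∞ a)
    (hP : P.HasDiffusionGenerator D a) (hc : Continuous uInf) (hpos : ∀ x, 0 < uInf x)
    {r : ℝ} (hr : 0 ≤ r) (s : ℝ≥0) (w : Space n → ℝ) (hw : Measurable w) (M : ℝ)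
    (hM : ∀ x, |w x| ≤ M) :
    ∫ y, (∫ x, w x ∂(P.kernel s y)) * (u r y / uInf y) ∂(densityMeasure uInf)
      = ∫ x, w x * (u (r + s) x / uInf x) ∂(densityMeasure uInf) := by
  have e : ∀ v z : Space n → ℝ, (fun x => z x * (v x / uInf x) * uInf x) = fun x => z x * v x := by
    intro v z
    ext x
    rw [mul_assoc, div_mul_cancel₀ _ (hpos x).ne']
  rw [integral_densityMeasure_of_pos hc hpos, integral_densityMeasure_of_pos hc hpos, e, e]
  exact hu.integral_act_mul hD ha hP hw hM hr s

/-- The relative density of the solution is Lipschitz in time, locally uniformly in space. -/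
lemma IsSolution.exists_abs_div_sub_le (hu : IsSolution D a P u)
    (hD : ∀ i j, ContDiff ℝ ∞ (fun x => D x i j)) (ha : ContDiff ℝ ∞ a)
    (hc : Continuous uInf) (hpos : ∀ x, 0 < uInf x) {t : ℝ} (ht : 0 < t) (y : Space n) :
    ∃ M : ℝ, ∀ s : ℝ≥0, s ≤ 1 → ∀ x ∈ Metric.closedBall y 1,
      |u (t + s) x / uInf x - u t x / uInf x| ≤ M * s := by
  obtain ⟨M, hM⟩ := hu.exists_abs_sub_le hD ha ht y 1
  obtain ⟨N, hN⟩ := (isCompact_closedBall y 1).exists_bound_of_continuousOn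
    (hc.inv₀ fun x => (hpos x).ne').continuousOn
  refine ⟨M * N, fun s hs x hx => ?_⟩
  have h1 := hM s s.2 (by exact_mod_cast hs) x hx
  rw [← sub_div, div_eq_mul_inv, abs_mul]
  calc _ ≤ M * s * N := mul_le_mul h1 (hN x hx) (abs_nonneg _) ((abs_nonneg _).trans h1)
    _ = M * N * s := by ring

lemma measurable_lintegral_bregman (hΦ : ConvexOn ℝ I Φ) (hΦ_smooth : ContDiffOn ℝ 2 Φ I)
    {κ : Kernel (Space n) (Space n)} [IsMarkovKernel κ] {p q : Space n → ℝ} (hp : Continuous p)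
    (hpI : ∀ x, p x ∈ I) (hq : Continuous q) (hqI : ∀ x, q x ∈ I) :
    Measurable fun y => ∫⁻ x, ENNReal.ofReal (bregman I Φ (p y) (q x)) ∂(κ y) := by
  have h1 : Continuous fun x => Φ (p x) := hΦ_smooth.continuousOn.comp_continuous hp hpI
  have h2 : Continuous fun x => Φ (q x) := hΦ_smooth.continuousOn.comp_continuous hq hqI
  have h3 : Continuous fun x => derivWithin Φ I (q x) :=
    (continuousOn_derivWithin_of_convex hΦ.1 hΦ_smooth).comp_continuous hq hqI
  refine Measurable.lintegral_kernel_prod_right (Continuous.measurable ?_)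
  refine ENNReal.continuous_ofReal.comp ?_
  exact ((h1.comp continuous_fst).sub (h2.comp continuous_snd)).sub
    ((h3.comp continuous_snd).mul ((hp.comp continuous_fst).sub (hq.comp continuous_snd)))

/-- Lower bound for the entropy dissipation. -/
lemma IsSolution.lintegral_le_liminf_bregman (hu : IsSolution D a P u)
    (hD : ∀ i j, ContDiff ℝ ∞ (fun x => D x i j)) (ha : ContDiff ℝ ∞ a)
    (hP : P.HasDiffusionGenerator D a) (hsmooth : ContDiff ℝ 2 uInf) (hpos : ∀ x, 0 < uInf x)
    (hΦ : ConvexOn ℝ I Φ) (hΦ_smooth : ContDiffOn ℝ 2 Φ I)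
    (huI : ∀ t, 0 ≤ t → ∀ x, u t x / uInf x ∈ I) {t : ℝ} (ht : 0 < t)
    {s : ℕ → ℝ≥0} (hs : Tendsto s atTop (𝓝[>] 0)) :
    ∫⁻ y, ENNReal.ofReal (iteratedDerivWithin 2 Φ I (u t y / uInf y)
        * carreDuChamp D a (fun x => u t x / uInf x) y) ∂(densityMeasure uInf)
      ≤ liminf (fun k => ENNReal.ofReal (1 / s k) * ∫⁻ y, ∫⁻ x, ENNReal.ofReal
        (bregman I Φ (u t y / uInf y) (u (t + s k) x / uInf x)) ∂(P.kernel (s k) y)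
        ∂(densityMeasure uInf)) atTop := by
  have hpc := hu.contDiff_div hsmooth hpos ht
  have hqc : ∀ r : ℝ≥0, Continuous fun x => u (t + r) x / uInf x := fun r =>
    (hu.contDiff_div hsmooth hpos (by positivity)).continuous
  have hqI : ∀ (r : ℝ≥0) x, u (t + r) x / uInf x ∈ I := fun r => huI _ (by positivity)
  have hmeas : ∀ k, Measurable fun y => ∫⁻ x, ENNReal.ofReal
      (bregman I Φ (u t y / uInf y) (u (t + s k) x / uInf x)) ∂(P.kernel (s k) y) := fun k =>
    measurable_lintegral_bregman hΦ hΦ_smooth hpc.continuous (huI t ht.le) (hqc _) (hqI _)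
  have hfatou := lintegral_liminf_le (μ := densityMeasure uInf) (u := atTop)
    (f := fun k y => ENNReal.ofReal (1 / s k) * ∫⁻ x, ENNReal.ofReal
      (bregman I Φ (u t y / uInf y) (u (t + s k) x / uInf x)) ∂(P.kernel (s k) y)) (fun k => (hmeas k).const_mul (ENNReal.ofReal (1 / s k)))
  simp_rw [lintegral_const_mul _ (hmeas _)] at hfatou
  refine le_trans (lintegral_mono fun y => ?_) hfatou
  obtain ⟨M, hM⟩ := hu.exists_abs_div_sub_le hD ha hsmooth.continuous hpos ht y
  refine le_of_forall_lt fun c hc => ?_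
  have hctop : c ≠ ⊤ := hc.ne_top
  -- An intermediate finite level supplies the strict inequality required by the pointwise estimate.
  obtain ⟨c', hcc', hc'⟩ := exists_between hc
  have hc'top : c' ≠ ⊤ := hc'.ne_top
  refine hcc'.trans_le ?_
  rw [ENNReal.lt_ofReal_iff_toReal_lt hc'top] at hc'
  refine le_liminf_of_le (by isBoundedDefault) ?_
  have := hs.eventually (eventually_le_lintegral_bregman hD hP hΦ hΦ_smooth hpc (huI t ht.le)
    (q := fun r x => u (t + r) x / uInf x) hqI hM ENNReal.toReal_nonneg hc')
  simpa only [ENNReal.ofReal_toReal hc'top] using this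

/-- If the entropy dissipated over each small time step `s` is at least the mean Bregman
divergence, then the entropy inequality makes the entropy decay at rate `1 / C`. -/
lemma IsSolution.exists_step (hu : IsSolution D a P u)
    (hD : ∀ i j, ContDiff ℝ ∞ (fun x => D x i j)) (hDpos : ∀ x, (D x).PosSemidef)
    (ha : ContDiff ℝ ∞ a)
    (hP : P.HasDiffusionGenerator D a) (hsmooth : ContDiff ℝ 2 uInf) (hpos : ∀ x, 0 < uInf x)
    (hΦ : ConvexOn ℝ I Φ) (hΦ_smooth : ContDiffOn ℝ 2 Φ I) {C : ℝ} (hC : 0 < C)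
    (hineq : PhiEntropyInequality D a (densityMeasure uInf) I Φ C)
    (huI : ∀ t, 0 ≤ t → ∀ x, u t x / uInf x ∈ I) {e : ℝ → ℝ} {t : ℝ} (ht : 0 < t)
    (hint : Integrable (fun x => Φ (u t x / uInf x)) (densityMeasure uInf))
    (he : phiEntropy (densityMeasure uInf) Φ (fun x => u t x / uInf x) = e t)
    (he0 : ∀ s, t ≤ s → 0 ≤ e s) (hmono : ∀ s, t ≤ s → e s ≤ e t)
    (hdiss : ∀ s : ℝ≥0, ∫⁻ y, ∫⁻ x, ENNReal.ofReal
        (bregman I Φ (u t y / uInf y) (u (t + s) x / uInf x)) ∂(P.kernel s y)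
        ∂(densityMeasure uInf) ≤ ENNReal.ofReal (e t - e (t + s)))
    {r : ℝ} (hr0 : 0 ≤ r) (hr : r < 1 / C) {δ : ℝ} (hδ : 0 < δ) :
    ∃ h, 0 < h ∧ h < δ ∧ e (t + h) ≤ e t * Real.exp (-r * h) := by
  rcases eq_or_lt_of_le (he0 t le_rfl) with h0 | h0
  · refine ⟨δ / 2, by positivity, by linarith, ?_⟩
    have := hmono (t + δ / 2) (by linarith)
    rw [← h0] at this ⊢
    simpa using this
  set g : Space n → ℝ := fun y => iteratedDerivWithin 2 Φ I (u t y / uInf y)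
    * carreDuChamp D a (fun x => u t x / uInf x) y with hg
  have hpc := hu.contDiff_div hsmooth hpos ht
  have hg0 : ∀ y, 0 ≤ g y := fun y => mul_nonneg (iteratedDerivWithin_two_nonneg hΦ hΦ_smooth _)
    (carreDuChamp_nonneg hD hDpos hpc y)
  have hgc : Continuous g :=
    ((continuousOn_iteratedDerivWithin_of_convex hΦ.1 hΦ_smooth).comp_continuous hpc.continuous
      (huI t ht.le)).mul (continuous_carreDuChamp hD hpc)
  have hlt : ENNReal.ofReal (r * e t) < ∫⁻ y, ENNReal.ofReal (g y) ∂(densityMeasure uInf) := by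
    -- With infinite dissipation the entropy inequality is silent, but the strict lower bound is
    -- then trivial.
    by_cases htop : ∫⁻ y, ENNReal.ofReal (g y) ∂(densityMeasure uInf) = ⊤
    · rw [htop]
      exact ENNReal.ofReal_lt_top
    · have hgi : Integrable g (densityMeasure uInf) :=
        (lintegral_ofReal_ne_top_iff_integrable hgc.aestronglyMeasurable
          (Eventually.of_forall hg0)).1 htop
      have h1 := hineq _ hpc (huI t ht.le)
        (integrable_densityMeasure_div hsmooth.continuous hpos (hu.integrable t ht.le)) hint hgi
      rw [he] at h1
      rw [← ofReal_integral_eq_lintegral_ofReal hgi (Eventually.of_forall hg0)]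
      have h2 : r * e t < ∫ y, g y ∂(densityMeasure uInf) := by
        have h3 : r * e t < 1 / C * e t := mul_lt_mul_of_pos_right hr h0
        refine h3.trans_le ?_
        rw [one_div, inv_mul_le_iff₀ hC]
        exact h1
      exact (ENNReal.ofReal_lt_ofReal_iff_of_nonneg (by positivity)).2 h2
  have hliminf := hlt.trans_le (hu.lintegral_le_liminf_bregman hD ha hP hsmooth hpos hΦ hΦ_smooth
    huI ht MarkovSemigroup.tendsto_one_div_nnreal)
  have hev := eventually_lt_of_lt_liminf hliminf
  have hsmall : ∀ᶠ k : ℕ in atTop, 1 / ((k : ℝ) + 1) < δ :=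
    tendsto_one_div_add_atTop_nhds_zero_nat.eventually (gt_mem_nhds hδ)
  obtain ⟨k, hk, hkδ⟩ := (hev.and hsmall).exists
  set s : ℝ≥0 := 1 / ((k : ℝ≥0) + 1) with hs
  have hsc : (s : ℝ) = 1 / ((k : ℝ) + 1) := by simp [hs]
  have hspos : (0 : ℝ) < s := by rw [hsc]; positivity
  refine ⟨s, hspos, by rwa [hsc], ?_⟩
  have hk' := hk.trans_le (mul_le_mul_right (hdiss s) (ENNReal.ofReal (1 / s)))
  rw [← ENNReal.ofReal_mul (by positivity), ENNReal.ofReal_lt_ofReal_iff_of_nonneg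
    (by positivity), one_div, lt_inv_mul_iff₀ hspos] at hk'
  -- At this point `s * (r * e t) < e t - e (t + s)`, that is `e (t + s) < (1 - r s) * e t`.
  have hexp := Real.add_one_le_exp (-r * s)
  have := mul_le_mul_of_nonneg_left hexp h0.le
  linarith

end Entropy

end FokkerPlanck

/-! ### Exponential decay of the entropy. -/

open FokkerPlanck in
theorem theorem3 (n : ℕ)
    -- smooth coefficients, `D` symmetric and nonnegative
    (D : FokkerPlanck.Space n → Matrix (Fin n) (Fin n) ℝ)
    (a : FokkerPlanck.Space n → FokkerPlanck.Space n)
    (hD : ∀ i j, ContDiff ℝ ∞ (fun x => D x i j))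
    (hDpos : ∀ x, (D x).PosSemidef)
    (ha : ContDiff ℝ ∞ a)
    -- the Markov semigroup with generator `L`
    (P : FokkerPlanck.MarkovSemigroup n)
    (hP : P.HasDiffusionGenerator D a)
    -- the invariant probability measure, with positive density `uInf`
    (uInf : FokkerPlanck.Space n → ℝ)
    (hu_smooth : ContDiff ℝ 2 uInf)
    (hu_pos : ∀ x, 0 < uInf x)
    (hu_prob : IsProbabilityMeasure (FokkerPlanck.densityMeasure uInf))
    (hu_inv : ∀ t, (P.kernel t).Invariant (FokkerPlanck.densityMeasure uInf))
    -- a `C²` convex function on an interval, and the entropy inequality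
    (I : Set ℝ) (Φ : ℝ → ℝ)
    (hΦ : ConvexOn ℝ I Φ)
    (hΦ_smooth : ContDiffOn ℝ 2 Φ I)
    (C : ℝ) (hC : 0 < C)
    (hineq : FokkerPlanck.PhiEntropyInequality D a (FokkerPlanck.densityMeasure uInf) I Φ C)
    -- a solution whose relative density is `I`-valued, with finite initial entropy
    (u : ℝ → FokkerPlanck.Space n → ℝ)
    (hu : FokkerPlanck.IsSolution D a P u)
    (huI : ∀ t, 0 ≤ t → ∀ x, u t x / uInf x ∈ I)
    (hu0 : Integrable (fun x => Φ (u 0 x / uInf x)) (FokkerPlanck.densityMeasure uInf)) :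
    (∀ t, 0 ≤ t →
      Integrable (fun x => u t x / uInf x) (FokkerPlanck.densityMeasure uInf) ∧
      Integrable (fun x => Φ (u t x / uInf x)) (FokkerPlanck.densityMeasure uInf) ∧
      FokkerPlanck.phiEntropy (FokkerPlanck.densityMeasure uInf) Φ (fun x => u t x / uInf x) ≤
        Real.exp (-t / C) *
          FokkerPlanck.phiEntropy (FokkerPlanck.densityMeasure uInf) Φ
            (fun x => u 0 x / uInf x)) ∧
    Tendsto
      (fun t : ℝ =>
        FokkerPlanck.phiEntropy (FokkerPlanck.densityMeasure uInf) Φ (fun x => u t x / uInf x))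
      atTop (𝓝 0) := by
  set μ := densityMeasure uInf with hμ
  have hc : Continuous uInf := hu_smooth.continuous
  have hfint : ∀ t, 0 ≤ t → Integrable (fun x => u t x / uInf x) μ := fun t ht =>
    integrable_densityMeasure_div hc hu_pos (hu.integrable t ht)
  set m := ∫ x, u 0 x / uInf x ∂μ with hm_def
  have hm : ∀ t, 0 ≤ t → ∫ x, u t x / uInf x ∂μ = m := by
    have h : ∀ t, ∫ x, u t x / uInf x ∂μ = ∫ x, u t x := fun t => by
      rw [hμ, integral_densityMeasure_of_pos hc hu_pos]
      simp only [div_mul_cancel₀ _ (hu_pos _).ne']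
    intro t ht
    rw [hm_def, h, h, hu.integral_eq ht]
  have hmI : m ∈ I := integral_mem_of_convex hΦ.1 (huI 0 le_rfl) (hfint 0 le_rfl)
  set d₀ := derivWithin Φ I m
  -- Subtracting the tangent at the conserved mean `m` makes the integrand nonnegative, leaves
  -- Bregman divergences unchanged, and turns the entropy into `∫ ψ(u_t / uInf) dμ`.
  set ψ : ℝ → ℝ := fun x => Φ x - Φ m - d₀ * (x - m) with hψ_def
  set d : ℝ → ℝ := fun x => derivWithin Φ I x - d₀ with hd_def
  have hψ : ContinuousOn ψ I := (hΦ_smooth.continuousOn.sub continuousOn_const).sub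
    (continuousOn_const.mul (continuousOn_id.sub continuousOn_const))
  have hd : ContinuousOn d I :=
    (continuousOn_derivWithin_of_convex hΦ.1 hΦ_smooth).sub continuousOn_const
  have hψ0 : ∀ x ∈ I, 0 ≤ ψ x := fun x hx => bregman_nonneg hΦ hΦ_smooth hx hmI
  have hbreg : ∀ x y, ψ x - ψ y - d y * (x - y) = bregman I Φ x y := fun x y => by
    simp only [hψ_def, hd_def, bregman]
    ring
  have hB : ∀ x ∈ I, ∀ y ∈ I, 0 ≤ ψ x - ψ y - d y * (x - y) := fun x hx y hy => by
    rw [hbreg]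
    exact bregman_nonneg hΦ hΦ_smooth hx hy
  have hcont : ∀ t, 0 < t → Continuous fun x => u t x / uInf x := fun t ht =>
    (hu.contDiff_div hu_smooth hu_pos ht).continuous
  have haff : ∀ t, 0 ≤ t → Integrable (fun x => Φ m + d₀ * (u t x / uInf x - m)) μ := fun t ht =>
    (integrable_const _).add (((hfint t ht).sub (integrable_const _)).const_mul _)
  have hψΦ : ∀ t, 0 ≤ t → (Integrable (fun x => ψ (u t x / uInf x)) μ ↔
      Integrable (fun x => Φ (u t x / uInf x)) μ) := by
    intro t ht
    refine ⟨fun h => (h.add (haff t ht)).congr (Eventually.of_forall fun x => ?_),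
      fun h => (h.sub (haff t ht)).congr (Eventually.of_forall fun x => ?_)⟩
    · simp only [hψ_def, Pi.add_apply]
      ring
    · simp only [hψ_def, Pi.sub_apply]
      ring
  have hψ_init := (hψΦ 0 le_rfl).2 hu0
  -- The version of Jensen without continuity of `p` is used so that `t = 0` is allowed: no
  -- continuity of `u 0` is assumed.
  have hle : ∀ (t : ℝ) (s : ℝ≥0), 0 ≤ t → 0 < s → Integrable (fun x => ψ (u t x / uInf x)) μ →
      ∫⁻ x, ENNReal.ofReal (ψ (u (t + s) x / uInf x)) ∂μ
        ≤ ∫⁻ x, ENNReal.ofReal (ψ (u t x / uInf x)) ∂μ := fun t s ht hs hi =>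
    lintegral_le_of_invariant (hu_inv s) hψ hd hψ0 hB (huI t ht) (hfint t ht) hi
      (hcont _ (by positivity)) (huI _ (by positivity))
      (hu.integral_act_mul_div hD ha hP hc hu_pos ht s)
  have hψint : ∀ t, 0 ≤ t → Integrable (fun x => ψ (u t x / uInf x)) μ := by
    intro t ht
    rcases eq_or_lt_of_le ht with rfl | ht'
    · exact hψ_init
    · have h0 : ∀ s, 0 ≤ s → 0 ≤ᵐ[μ] fun x => ψ (u s x / uInf x) := fun s hs =>
        Eventually.of_forall fun x => hψ0 _ (huI s hs x)
      refine (lintegral_ofReal_ne_top_iff_integrable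
        (hψ.comp_continuous (hcont t ht') (huI t ht)).aestronglyMeasurable (h0 t ht)).1 ?_
      have h1 := hle 0 t.toNNReal le_rfl (Real.toNNReal_pos.2 ht') hψ_init
      rw [Real.coe_toNNReal _ ht, zero_add] at h1
      exact ne_top_of_le_ne_top ((lintegral_ofReal_ne_top_iff_integrable
        hψ_init.aestronglyMeasurable (h0 0 le_rfl)).2 hψ_init) h1
  have hΦint : ∀ t, 0 ≤ t → Integrable (fun x => Φ (u t x / uInf x)) μ := fun t ht =>
    (hψΦ t ht).1 (hψint t ht)
  set e : ℝ → ℝ := fun t => ∫ x, ψ (u t x / uInf x) ∂μ with he_def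
  have he0 : ∀ t, 0 ≤ t → 0 ≤ e t := fun t ht =>
    integral_nonneg fun x => hψ0 _ (huI t ht x)
  have hent : ∀ t, 0 ≤ t → phiEntropy μ Φ (fun x => u t x / uInf x) = e t := by
    intro t ht
    have h1 : e t = (∫ x, Φ (u t x / uInf x) ∂μ) - ∫ x, (Φ m + d₀ * (u t x / uInf x - m)) ∂μ := by
      rw [he_def, ← integral_sub (hΦint t ht) (haff t ht)]
      refine integral_congr_ae (Eventually.of_forall fun x => ?_)
      simp only [hψ_def]
      ring
    have i1 : Integrable (fun x => u t x / uInf x - m) μ := (hfint t ht).sub (integrable_const _)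
    rw [h1, integral_add (integrable_const _) (i1.const_mul _),
      integral_const_mul, integral_sub (hfint t ht) (integrable_const _), hm t ht, phiEntropy,
      hm t ht]
    simp
  have hlint : ∀ t, 0 ≤ t →
      ∫⁻ x, ENNReal.ofReal (ψ (u t x / uInf x)) ∂μ = ENNReal.ofReal (e t) := fun t ht =>
    (ofReal_integral_eq_lintegral_ofReal (hψint t ht)
      (Eventually.of_forall fun x => hψ0 _ (huI t ht x))).symm
  have hmono : ∀ s t, 0 ≤ s → s ≤ t → e t ≤ e s := by
    intro s t hs hst
    rcases eq_or_lt_of_le hst with rfl | hst'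
    · exact le_rfl
    · have h := hle s (t - s).toNNReal hs (Real.toNNReal_pos.2 (sub_pos.2 hst')) (hψint s hs)
      rw [Real.coe_toNNReal _ (sub_nonneg.2 hst), add_sub_cancel] at h
      rw [hlint t (hs.trans hst), hlint s hs] at h
      exact (ENNReal.ofReal_le_ofReal_iff (he0 s hs)).1 h
  have hdiss : ∀ t, 0 < t → ∀ s : ℝ≥0, ∫⁻ y, ∫⁻ x, ENNReal.ofReal
      (bregman I Φ (u t y / uInf y) (u (t + s) x / uInf x)) ∂(P.kernel s y) ∂μ
      ≤ ENNReal.ofReal (e t - e (t + s)) := by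
    intro t ht s
    have hts : 0 < t + s := by positivity
    have h := lintegral_add_bregman_le (hu_inv s) hψ hd hψ0 hB (huI t ht.le) (hfint t ht.le)
      (hψint t ht.le) (hcont t ht) (hcont _ hts) (huI _ hts.le)
      (hu.integral_act_mul_div hD ha hP hc hu_pos ht.le s)
    simp_rw [hbreg] at h
    rw [hlint t ht.le, hlint _ hts.le] at h
    rw [ENNReal.ofReal_sub _ (he0 _ hts.le)]
    exact ENNReal.le_sub_of_add_le_left ENNReal.ofReal_ne_top h
  have hdecay_pos : ∀ s t, 0 < s → s ≤ t → ∀ r, 0 ≤ r → r < 1 / C →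
      e t ≤ e s * Real.exp (-r * (t - s)) := by
    intro s t hs hst r hr0 hr
    refine le_mul_exp_of_frequently_step hst (fun x y hx hxy => hmono x y (hs.le.trans hx) hxy)
      fun x hx δ hδ => ?_
    have hx0 : 0 < x := hs.trans_le hx
    exact hu.exists_step hD hDpos ha hP hu_smooth hu_pos hΦ hΦ_smooth hC hineq huI hx0
      (hΦint x hx0.le) (hent x hx0.le) (fun y hy => he0 y (hx0.le.trans hy))
      (fun y hy => hmono x y hx0.le hy) (hdiss x hx0) hr0 hr hδ
  have hdecay : ∀ t, 0 ≤ t → e t ≤ Real.exp (-t / C) * e 0 := by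
    intro t ht
    rcases eq_or_lt_of_le ht with rfl | ht'
    · simp
    have h1 : ∀ r, 0 < r → r < 1 / C → e t ≤ e 0 * Real.exp (-r * t) := by
      intro r hr0 hr
      have hlim : Tendsto (fun s : ℝ => e 0 * Real.exp (-r * (t - s))) (𝓝[>] 0)
          (𝓝 (e 0 * Real.exp (-r * (t - 0)))) := by
        have : Continuous fun s : ℝ => e 0 * Real.exp (-r * (t - s)) := by fun_prop
        exact (this.tendsto 0).mono_left nhdsWithin_le_nhds
      rw [sub_zero] at hlim
      refine ge_of_tendsto hlim ?_
      filter_upwards [Ioo_mem_nhdsGT ht'] with s hs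
      refine (hdecay_pos s t hs.1 hs.2.le r hr0.le hr).trans ?_
      -- Letting `s → 0` needs only `e s ≤ e 0`, not continuity of the entropy at the initial time.
      exact mul_le_mul_of_nonneg_right (hmono 0 s le_rfl hs.1.le) (Real.exp_pos _).le
    have hlim : Tendsto (fun r : ℝ => e 0 * Real.exp (-r * t)) (𝓝[<] (1 / C))
        (𝓝 (e 0 * Real.exp (-(1 / C) * t))) := by
      have : Continuous fun r : ℝ => e 0 * Real.exp (-r * t) := by fun_prop
      exact (this.tendsto (1 / C)).mono_left nhdsWithin_le_nhds
    rw [mul_comm, show -t / C = -(1 / C) * t by ring]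
    refine ge_of_tendsto hlim ?_
    filter_upwards [Ioo_mem_nhdsLT (one_div_pos.2 hC)] with r hr using h1 r hr.1 hr.2
  refine ⟨fun t ht => ⟨hfint t ht, hΦint t ht, ?_⟩, ?_⟩
  · rw [hent t ht, hent 0 le_rfl]
    exact hdecay t ht
  · have hlim : Tendsto (fun t : ℝ => Real.exp (-t / C) * e 0) atTop (𝓝 0) := by
      have h1 : Tendsto (fun t : ℝ => t / C) atTop atTop := tendsto_id.atTop_div_const hC
      have h2 := (Real.tendsto_exp_neg_atTop_nhds_zero.comp h1).mul_const (e 0)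
      rw [zero_mul] at h2
      refine h2.congr fun t => ?_
      simp only [Function.comp_apply, neg_div]
    refine squeeze_zero' ?_ ?_ hlim
    · filter_upwards [eventually_ge_atTop 0] with t ht
      rw [hent t ht]
      exact he0 t ht
    · filter_upwards [eventually_ge_atTop 0] with t ht
      rw [hent t ht]
      exact hdecay t ht
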